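/- Let $\mathbb F$ be a field, $n\ge 0$, and let $R=\mathbb F[X_1,\dots,X_n]$ be $\mathbb Z$-graded with $\deg X_i=d_i\ge 1$. Let $M\neq 0$ be a finitely generated graded $R$-module, with Hilbert series $H_M(t)=\sum_{j\in\mathbb Z}(\dim_{\mathbb F}M_j)t^j\in\mathbb Z[[t]][t^{-1}]$. For a nonzero finitely generated graded $R$-module $N$ let $\operatorname{depth}(N)$ be the maximal length of an $N$-regular sequence in $\mathfrak m=(X_1,\dots,X_n)$. Put $$\operatorname{Hdep}(M)=\max\{r\in\mathbb N : \text{there is a finitely generated graded } R\text{-module } N \text{ with } H_N=H_M \text{ and } \operatorname{depth}(N)=r\},$$ and let $\nu(M)$ be the maximal $r\in\mathbb N$ such that there is a decomposition $$H_M(t)=\sum_{I\subseteq\{1,\dots,n\}}\frac{Q_I(t)}{\prod_{i\in I}(1-t^{d_i})}$$ in which all $Q_I\in\mathbb Z[t,t^{-1}]$ have nonnegative coefficients and $Q_I=0$ for all $I$ with $|I|<r$. Here $\mathbb N$ includes $0$. Then both maxima exist, and if $\operatorname{Hdep}(M)\le 1$ or $\operatorname{Hdep}(M)=n$, then $\nu(M)=\operatorname{Hdep}(M)$.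 -/

import Mathlib

universe u v

namespace HilbertDepth

open MvPolynomial

/-- `𝓜 = (M_j)_{j ∈ ℤ}` makes `M` a graded module over `R = F[X_1, …, X_n]`, where `R` carries the
`ℤ`-grading with `deg X_i = d i`: one has `M = ⨁_j M_j` and `R_i • M_j ⊆ M_{i+j}`. -/
structure IsGradedModule {F : Type u} [Field F] {n : ℕ} (d : Fin n → ℕ)
    {M : Type v} [AddCommGroup M] [Module F M] [Module (MvPolynomial (Fin n) F) M]
    (𝓜 : ℤ → Submodule F M) : Prop where
  isInternal : DirectSum.IsInternal 𝓜
  gradedSMul :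
    SetLike.GradedSMul (weightedHomogeneousSubmodule F fun i : Fin n => (d i : ℤ)) 𝓜

/-- A finitely generated graded `R`-module. -/
structure IsFGGradedModule {F : Type u} [Field F] {n : ℕ} (d : Fin n → ℕ)
    {M : Type v} [AddCommGroup M] [Module F M] [Module (MvPolynomial (Fin n) F) M]
    (𝓜 : ℤ → Submodule F M) : Prop extends IsGradedModule d 𝓜 where
  finite : Module.Finite (MvPolynomial (Fin n) F) M

/-- The Hilbert function `j ↦ dim_F M_j`. -/
noncomputable def hilbertFunction {F : Type u} [Field F] {M : Type v} [AddCommGroup M] [Module F M]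
    (𝓜 : ℤ → Submodule F M) (j : ℤ) : ℤ :=
  (Module.finrank F (𝓜 j) : ℤ)

/-- `M_j = 0` for `j ≪ 0`. -/
theorem IsFGGradedModule.bddBelow_support {F : Type u} [Field F] {n : ℕ} {d : Fin n → ℕ}
    {M : Type v} [AddCommGroup M] [Module F M] [Module (MvPolynomial (Fin n) F) M]
    {𝓜 : ℤ → Submodule F M} (h : IsFGGradedModule d 𝓜) :
    BddBelow (Function.support (hilbertFunction 𝓜)) := by
  classical
  let P : ℤ → Submodule F M := fun b => ⨆ i : Set.Ici b, 𝓜 i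
  have hP : ∀ b i, b ≤ i → 𝓜 i ≤ P b := fun b i hbi =>
    le_iSup (fun i : Set.Ici b => 𝓜 i) ⟨i, hbi⟩
  have hanti : ∀ a b, a ≤ b → P b ≤ P a := fun a b hab =>
    iSup_le fun i => hP a i (hab.trans i.2)
  have hsmul : ∀ b (p : MvPolynomial (Fin n) F) (m : M), m ∈ P b → p • m ∈ P b := by
    intro b p m hm
    refine Submodule.iSup_induction (fun i : Set.Ici b => 𝓜 i)
      (motive := fun m => p • m ∈ P b) hm ?_ ?_ ?_
    · intro i x hx
      rw [p.as_sum, Finset.sum_smul]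
      refine Submodule.sum_mem _ fun e _ => ?_
      have h1 : monomial e (coeff e p) ∈
          weightedHomogeneousSubmodule F (fun i : Fin n => (d i : ℤ))
            (Finsupp.weight (fun i : Fin n => (d i : ℤ)) e) :=
        isWeightedHomogeneous_monomial _ _ _ rfl
      refine hP b _ ?_ (h.gradedSMul.smul_mem h1 hx)
      have h2 : 0 ≤ Finsupp.weight (fun i : Fin n => (d i : ℤ)) e := by
        rw [Finsupp.weight_apply]
        exact Finset.sum_nonneg fun i _ => by positivity
      have := i.2
      simp only [Set.mem_Ici] at this
      simp only [vadd_eq_add]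
      omega
    · simp
    · intro x y hx hy
      rw [smul_add]
      exact add_mem hx hy
  have hex : ∀ m : M, ∃ b, m ∈ P b := by
    intro m
    have hm : m ∈ ⨆ i, 𝓜 i := by
      rw [h.isInternal.submodule_iSup_eq_top]; trivial
    refine Submodule.iSup_induction 𝓜 (motive := fun m => ∃ b, m ∈ P b) hm ?_ ?_ ?_
    · exact fun i x hx => ⟨i, hP i i le_rfl hx⟩
    · exact ⟨0, zero_mem _⟩
    · rintro x y ⟨a, ha⟩ ⟨b, hb⟩
      exact ⟨min a b, add_mem (hanti _ _ (min_le_left _ _) ha) (hanti _ _ (min_le_right _ _) hb)⟩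
  obtain ⟨S, hS⟩ := h.finite.fg_top
  choose f hf using hex
  obtain ⟨b, hb⟩ : BddBelow (f '' (S : Set M)) := (S.finite_toSet.image f).bddBelow
  have htop : ∀ m : M, m ∈ P b := by
    intro m
    have hm : m ∈ Submodule.span (MvPolynomial (Fin n) F) (S : Set M) := by rw [hS]; trivial
    induction hm using Submodule.span_induction with
    | mem x hx => exact hanti _ _ (hb ⟨x, hx, rfl⟩) (hf x)
    | zero => exact zero_mem _
    | add x y _ _ hx hy => exact add_mem hx hy
    | smul p x _ hx => exact hsmul b p x hx
  refine ⟨b, fun j hj => ?_⟩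
  by_contra hlt
  apply hj
  have hdis := h.isInternal.submodule_iSupIndep j
  have hle : P b ≤ ⨆ i, ⨆ (_ : i ≠ j), 𝓜 i := iSup_le fun i => by
    refine le_iSup₂_of_le (i : ℤ) ?_ le_rfl
    have := i.2
    simp only [Set.mem_Ici] at this
    omega
  have hbot : 𝓜 j = ⊥ := by
    rw [eq_bot_iff]
    intro x hx
    exact (Submodule.disjoint_def.mp hdis) x hx (hle (htop x))
  change ((Module.finrank F (𝓜 j) : ℕ) : ℤ) = 0
  rw [hbot, finrank_bot]
  rfl

/-- The Hilbert series `H_M(t) = ∑_j (dim_F M_j) t^j ∈ ℤ[[t]][t⁻¹]`. -/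
noncomputable def hilbertSeries {F : Type u} [Field F] {n : ℕ} {d : Fin n → ℕ}
    {M : Type v} [AddCommGroup M] [Module F M] [Module (MvPolynomial (Fin n) F) M]
    {𝓜 : ℤ → Submodule F M} (h : IsFGGradedModule d 𝓜) : LaurentSeries ℤ :=
  HahnSeries.ofSuppBddBelow (hilbertFunction 𝓜) h.bddBelow_support

/-- The graded maximal ideal `𝔪 = (X_1, …, X_n)`. -/
noncomputable def maxIdeal (F : Type u) [Field F] (n : ℕ) : Ideal (MvPolynomial (Fin n) F) :=
  Ideal.span (Set.range X)

/-- The depth of an `F[X_1, …, X_n]`-module `M`: the maximal length of an `M`-regular sequence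
in `𝔪` (in general a supremum in `ℕ ∪ {∞}`). -/
noncomputable def depth (F : Type u) [Field F] (n : ℕ) (M : Type v) [AddCommGroup M]
    [Module (MvPolynomial (Fin n) F) M] : ℕ∞ :=
  ⨆ rs : {rs : List (MvPolynomial (Fin n) F) //
    (∀ r ∈ rs, r ∈ maxIdeal F n) ∧ RingTheory.Sequence.IsRegular M rs}, (rs.1.length : ℕ∞)

/-- The set of all `r ∈ ℕ` for which there is a finitely generated graded `R`-module `N` with
`H_N = H` and `depth N = r`. (Every finitely generated `R`-module is isomorphic to one in the
universe of `F`.) -/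
def hilbertDepthSet (F : Type u) [Field F] {n : ℕ} (d : Fin n → ℕ) (H : LaurentSeries ℤ) : Set ℕ :=
  {r | ∃ (N : Type u) (_ : AddCommGroup N) (_ : Module F N)
      (_ : Module (MvPolynomial (Fin n) F) N) (_ : IsScalarTower F (MvPolynomial (Fin n) F) N)
      (𝓝 : ℤ → Submodule F N) (h : IsFGGradedModule d 𝓝),
      hilbertSeries h = H ∧ depth F n N = r}

/-- The Hilbert depth of a module with Hilbert series `H`. -/
noncomputable def Hdep (F : Type u) [Field F] {n : ℕ} (d : Fin n → ℕ) (H : LaurentSeries ℤ) : ℕ :=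
  sSup (hilbertDepthSet F d H)

/-- A Laurent polynomial regarded as a Laurent series. -/
noncomputable def laurentPolynomialToSeries (Q : LaurentPolynomial ℤ) : LaurentSeries ℤ :=
  Q.coeff.sum fun k a => HahnSeries.single k a

/-- The factor `1 - t^e` in `ℤ[[t]][t⁻¹]`. -/
noncomputable def oneSubT (e : ℕ) : LaurentSeries ℤ :=
  1 - HahnSeries.single (e : ℤ) 1

/-- For `e ≥ 1` the factor `1 - t^e` is invertible, so that `Ring.inverse` below yields its actual
inverse. -/
theorem isUnit_oneSubT {e : ℕ} (he : 1 ≤ e) : IsUnit (oneSubT e) := by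
  apply HahnSeries.isUnit_of_orderTop_pos
  have h : oneSubT e - 1 = -HahnSeries.single (e : ℤ) 1 := by
    unfold oneSubT; ring
  rw [h, HahnSeries.orderTop_neg, HahnSeries.orderTop_single one_ne_zero]
  exact_mod_cast he

/-- `H(t) = ∑_{I ⊆ {1, …, n}} Q_I(t) / ∏_{i ∈ I} (1 - t^{d_i})` with nonnegative
`Q_I ∈ ℤ[t, t⁻¹]`. -/
def IsDecomposition {n : ℕ} (d : Fin n → ℕ) (H : LaurentSeries ℤ)
    (Q : Finset (Fin n) → LaurentPolynomial ℤ) : Prop :=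
  (∀ I k, 0 ≤ (Q I).coeff k) ∧
    H = ∑ I : Finset (Fin n),
      laurentPolynomialToSeries (Q I) * Ring.inverse (∏ i ∈ I, oneSubT (d i))

/-- The set of all `r ∈ ℕ` such that `H` admits a decomposition with `Q_I = 0` for all `I` with
`|I| < r`. -/
def nuSet {n : ℕ} (d : Fin n → ℕ) (H : LaurentSeries ℤ) : Set ℕ :=
  {r | ∃ Q, IsDecomposition d H Q ∧ ∀ I : Finset (Fin n), I.card < r → Q I = 0}

/-- The invariant `ν(H)`. -/
noncomputable def nu {n : ℕ} (d : Fin n → ℕ) (H : LaurentSeries ℤ) : ℕ :=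
  sSup (nuSet d H)

end HilbertDepth

/-!
The invariant `ν` and the Hilbert depth are both at most `n`, and the comparison rests on three
constructions.

*Decompositions from modules.* For a finitely generated graded module `M` and a variable `X_s`, let
`T` be the `X_s`-power torsion of `M`. Then `X_s` is regular on `M / T`, so that
`H_M = H_T + H_{N} / (1 - t^{d_s})` with `N = (M / T) / X_s (M / T)`, and `X_s` acts nilpotently on
`T` and on `N`. Iterating over the variables yields a decomposition of `H_M`
(`exists_isDecomposition_of_nilpotent`). Its numerator for `I = ∅` comes from a submodule of `M`
on which all variables are nilpotent; such a submodule is zero if `M` has zero socle, in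
particular if `depth M ≥ 1`. This gives `ν ≥ 1` whenever the Hilbert depth is at least `1`.

*Modules of maximal depth.* If `depth N = n`, then `X_1, …, X_n` is `N`-regular, whence
`H_N ∏ (1 - t^{d_i})` is the Laurent polynomial `H_{N / 𝔪 N}`, and `ν = n`
(`exists_hilbertSeries_mul_prod_eq`). The regular sequences in the definition of depth need not be
homogeneous. A regular sequence of length `r` produces a chain of primes of length `r` above every
associated prime `P ⊆ 𝔪`, so that `r ≤ dim R / P` (`length_le_ringKrullDim_quotient`); this bounds
the depth by `n`, and it shows that `X_s` is regular: otherwise some `P` would contain `X_s` and the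
variables already divided out. Rees' theorem shows that dividing
by `X_s` lowers the depth by at most one.

*Modules from decompositions.* A decomposition with `Q_I = 0` for `|I| < r` is the Hilbert series of
a direct sum of shifted copies of the rings `F[X_i : i ∈ I]` with `|I| ≥ r`. For `r ≤ 2`, all that
is needed, the sequence `∑ X_i, ∑ X_i^{i + 1}` (shortened to length `r`) is regular on
all these rings at once, over every field (`exists_isWeaklyRegular_pi`). So `ν` cannot exceed a
Hilbert depth which is at most `1`.
-/

namespace HilbertDepth

open MvPolynomial RingTheory.Sequence
open scoped Pointwise

/-! ### Gradings on submodules and quotients -/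

section Components

variable {F : Type u} [Field F] {M : Type v} [AddCommGroup M] [Module F M] {𝓜 : ℤ → Submodule F M}

theorem coeLinearMap_bijective (h : DirectSum.IsInternal 𝓜) :
    Function.Bijective (DirectSum.coeLinearMap 𝓜) := h

/-- The projection of `M = ⨁ M_j` onto its component of degree `j`, as an endomorphism of `M`. -/
noncomputable def homogComponent (h : DirectSum.IsInternal 𝓜) (j : ℤ) : M →ₗ[F] M :=
  (𝓜 j).subtype ∘ₗ DirectSum.component F ℤ (fun i => 𝓜 i) j ∘ₗ
    (LinearEquiv.ofBijective _ (coeLinearMap_bijective h)).symm.toLinearMap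

theorem homogComponent_mem (h : DirectSum.IsInternal 𝓜) (j : ℤ) (x : M) :
    homogComponent h j x ∈ 𝓜 j := by
  simp [homogComponent]

theorem homogComponent_of_mem (h : DirectSum.IsInternal 𝓜) {i : ℤ} (j : ℤ) {x : M}
    (hx : x ∈ 𝓜 i) : homogComponent h j x = if i = j then x else 0 := by
  have : (LinearEquiv.ofBijective _ (coeLinearMap_bijective h)).symm x =
      DirectSum.lof F ℤ (fun i => 𝓜 i) i ⟨x, hx⟩ := by
    rw [LinearEquiv.symm_apply_eq]
    simp
  simp only [homogComponent, LinearMap.comp_apply, LinearEquiv.coe_coe, this]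
  split_ifs with hij
  · subst hij
    simp
  · simp [DirectSum.component.of, hij]

theorem homogComponent_self (h : DirectSum.IsInternal 𝓜) {j : ℤ} {x : M}
    (hx : x ∈ 𝓜 j) : homogComponent h j x = x := by
  simp [homogComponent_of_mem h j hx]

theorem exists_sum_homogComponent (h : DirectSum.IsInternal 𝓜) (x : M) :
    ∃ s : Finset ℤ, ∑ j ∈ s, homogComponent h j x = x := by
  classical
  obtain ⟨v, rfl⟩ := h.surjective x
  refine ⟨DFinsupp.support v, ?_⟩
  have : ∀ j, homogComponent h j (DirectSum.coeLinearMap 𝓜 v) = v j := by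
    intro j
    simp only [homogComponent, LinearMap.comp_apply, LinearEquiv.coe_coe]
    rw [show DirectSum.coeLinearMap 𝓜 v =
      LinearEquiv.ofBijective _ (coeLinearMap_bijective h) v from rfl,
      LinearEquiv.symm_apply_apply]
    rfl
  change ∑ j ∈ _, homogComponent h j (DirectSum.coeLinearMap 𝓜 v) = DirectSum.coeLinearMap 𝓜 v
  simp_rw [this]
  rw [DirectSum.coeLinearMap_eq_dfinsuppSum]
  rfl

/-- A family of subspaces is a grading if it admits projections onto its members which behave like
projections onto homogeneous components. -/
theorem isInternal_of_components (π : ℤ → M →ₗ[F] M)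
    (hself : ∀ j, ∀ x ∈ 𝓜 j, π j x = x) (hne : ∀ i j, i ≠ j → ∀ x ∈ 𝓜 i, π j x = 0)
    (hmem : ∀ j x, π j x ∈ 𝓜 j) (hsum : ∀ x, ∃ s : Finset ℤ, ∑ j ∈ s, π j x = x) :
    DirectSum.IsInternal 𝓜 := by
  classical
  rw [DirectSum.isInternal_submodule_iff_iSupIndep_and_iSup_eq_top]
  constructor
  · intro j
    rw [Submodule.disjoint_def]
    intro x hx hx'
    have hle : (⨆ i, ⨆ (_ : i ≠ j), 𝓜 i) ≤ LinearMap.ker (π j) :=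
      iSup₂_le fun i hi y hy => hne i j hi y hy
    rw [← hself j x hx]
    exact hle hx'
  · rw [eq_top_iff]
    intro x _
    obtain ⟨s, hs⟩ := hsum x
    rw [← hs]
    exact Submodule.sum_mem _ fun j _ => Submodule.mem_iSup_of_mem j (hmem j x)

/-- Every linear map of graded vector spaces which raises degrees by `e` commutes with the
projections onto the components. -/
theorem map_homogComponent {N : Type*} [AddCommGroup N] [Module F N] {𝓝 : ℤ → Submodule F N}
    (hM : DirectSum.IsInternal 𝓜) (hN : DirectSum.IsInternal 𝓝) (e : ℤ) (f : M →ₗ[F] N)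
    (hf : ∀ j, ∀ x ∈ 𝓜 j, f x ∈ 𝓝 (j + e)) (j : ℤ) (x : M) :
    homogComponent hN (j + e) (f x) = f (homogComponent hM j x) := by
  obtain ⟨s, hs⟩ := exists_sum_homogComponent hM x
  suffices ∀ y ∈ (⨆ i, 𝓜 i), homogComponent hN (j + e) (f y) = f (homogComponent hM j y) by
    apply this
    rw [← hs]
    exact Submodule.sum_mem _ fun i _ => Submodule.mem_iSup_of_mem i (homogComponent_mem hM i x)
  intro y hy
  induction hy using Submodule.iSup_induction' with
  | mem i y hy =>
    rw [homogComponent_of_mem hN _ (hf i y hy), homogComponent_of_mem hM _ hy]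
    by_cases h : i = j <;> simp [h]
  | zero => simp
  | add y z _ _ hy hz => simp [hy, hz]

end Components

section Modules

variable {F : Type u} [Field F] {n : ℕ} {d : Fin n → ℕ}
  {M : Type v} [AddCommGroup M] [Module F M] [Module (MvPolynomial (Fin n) F) M]
  {𝓜 : ℤ → Submodule F M}

theorem IsGradedModule.monomial_smul_mem (h : IsGradedModule d 𝓜) {j : ℤ} {x : M} (hx : x ∈ 𝓜 j)
    (e : Fin n →₀ ℕ) (a : F) :
    monomial e a • x ∈ 𝓜 (Finsupp.weight (fun i => (d i : ℤ)) e + j) :=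
  h.gradedSMul.smul_mem (isWeightedHomogeneous_monomial _ _ _ rfl) hx

theorem IsGradedModule.X_pow_smul_mem (h : IsGradedModule d 𝓜) {j : ℤ} {x : M} (hx : x ∈ 𝓜 j)
    (i : Fin n) (k : ℕ) :
    (X i ^ k : MvPolynomial (Fin n) F) • x ∈ 𝓜 (j + k * d i) := by
  have := h.monomial_smul_mem hx (Finsupp.single i k) 1
  rw [← X_pow_eq_monomial] at this
  simpa [Finsupp.weight_single, add_comm] using this

theorem IsGradedModule.X_smul_mem (h : IsGradedModule d 𝓜) {j : ℤ} {x : M} (hx : x ∈ 𝓜 j)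
    (i : Fin n) : (X i : MvPolynomial (Fin n) F) • x ∈ 𝓜 (j + d i) := by
  simpa using h.X_pow_smul_mem hx i 1

variable [IsScalarTower F (MvPolynomial (Fin n) F) M]

theorem IsGradedModule.homogComponent_X_pow_smul (h : IsGradedModule d 𝓜) (i : Fin n) (k : ℕ)
    (j : ℤ) (x : M) :
    homogComponent h.isInternal (j + k * d i) ((X i ^ k : MvPolynomial (Fin n) F) • x) =
      (X i ^ k : MvPolynomial (Fin n) F) • homogComponent h.isInternal j x :=
  map_homogComponent h.isInternal h.isInternal _
    (Algebra.lsmul F F M (X i ^ k : MvPolynomial (Fin n) F))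
    (fun _ _ hx => h.X_pow_smul_mem hx i k) j x

/-- A submodule of a graded module is homogeneous if it contains the homogeneous components of its
elements. -/
def IsHomogeneousSubmodule (h : IsGradedModule d 𝓜)
    (U : Submodule (MvPolynomial (Fin n) F) M) : Prop :=
  ∀ x ∈ U, ∀ j, homogComponent h.isInternal j x ∈ U

/-- The grading induced on a submodule. -/
noncomputable def subGrading (𝓜 : ℤ → Submodule F M)
    (U : Submodule (MvPolynomial (Fin n) F) M) (j : ℤ) : Submodule F U :=
  (𝓜 j).comap (U.subtype.restrictScalars F)

/-- The grading induced on a quotient module. -/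
noncomputable def quotGrading (𝓜 : ℤ → Submodule F M)
    (U : Submodule (MvPolynomial (Fin n) F) M) (j : ℤ) : Submodule F (M ⧸ U) :=
  (𝓜 j).map (U.mkQ.restrictScalars F)

theorem IsHomogeneousSubmodule.isGradedModule {h : IsGradedModule d 𝓜}
    {U : Submodule (MvPolynomial (Fin n) F) M} (hU : IsHomogeneousSubmodule h U) :
    IsGradedModule d (subGrading 𝓜 U) where
  isInternal := by
    refine isInternal_of_components (fun j => ((homogComponent h.isInternal j).comp
      (U.subtype.restrictScalars F)).codRestrict (U.restrictScalars F) fun x => hU x x.2 j)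
      ?_ ?_ ?_ ?_
    · intro j x hx
      exact Subtype.ext (homogComponent_self h.isInternal hx)
    · intro i j hij x hx
      exact Subtype.ext ((homogComponent_of_mem h.isInternal j hx).trans (if_neg hij))
    · intro j x
      exact homogComponent_mem h.isInternal j _
    · intro x
      obtain ⟨s, hs⟩ := exists_sum_homogComponent h.isInternal (x : M)
      refine ⟨s, Subtype.ext ?_⟩
      rw [AddSubmonoidClass.coe_finsetSum]
      exact hs
  gradedSMul := ⟨fun {_ _ _ _} ha hb => h.gradedSMul.smul_mem ha hb⟩

theorem IsHomogeneousSubmodule.isGradedModule_quotient {h : IsGradedModule d 𝓜}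
    {U : Submodule (MvPolynomial (Fin n) F) M} (hU : IsHomogeneousSubmodule h U) :
    IsGradedModule d (quotGrading 𝓜 U) where
  isInternal := by
    let π : ℤ → (M ⧸ U) →ₗ[F] (M ⧸ U) := fun j =>
      (U.restrictScalars F).mapQ (U.restrictScalars F) (homogComponent h.isInternal j)
        fun x hx => hU x hx j
    have hπ : ∀ j x, π j (U.mkQ x) = U.mkQ (homogComponent h.isInternal j x) := fun _ _ => rfl
    refine isInternal_of_components π ?_ ?_ ?_ ?_
    · rintro j _ ⟨x, hx, rfl⟩
      exact (hπ j x).trans (congrArg _ (homogComponent_self h.isInternal hx))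
    · rintro i j hij _ ⟨x, hx, rfl⟩
      refine (hπ j x).trans ?_
      rw [homogComponent_of_mem h.isInternal j hx, if_neg hij, map_zero]
    · intro j x
      obtain ⟨x, rfl⟩ := U.mkQ_surjective x
      exact ⟨_, homogComponent_mem h.isInternal j x, rfl⟩
    · intro x
      obtain ⟨x, rfl⟩ := U.mkQ_surjective x
      obtain ⟨s, hs⟩ := exists_sum_homogComponent h.isInternal x
      refine ⟨s, ?_⟩
      simp_rw [hπ]
      rw [← map_sum, hs]
  gradedSMul := ⟨by
    rintro i j a _ ha ⟨x, hx, rfl⟩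
    exact ⟨a • x, h.gradedSMul.smul_mem ha hx, by simp⟩⟩

theorem IsFGGradedModule.submodule (h : IsFGGradedModule d 𝓜)
    {U : Submodule (MvPolynomial (Fin n) F) M} (hU : IsHomogeneousSubmodule h.toIsGradedModule U) :
    IsFGGradedModule d (subGrading 𝓜 U) :=
  { hU.isGradedModule with
    finite := by
      have := h.finite
      infer_instance }

theorem IsFGGradedModule.quotient (h : IsFGGradedModule d 𝓜)
    {U : Submodule (MvPolynomial (Fin n) F) M} (hU : IsHomogeneousSubmodule h.toIsGradedModule U) :
    IsFGGradedModule d (quotGrading 𝓜 U) :=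
  { hU.isGradedModule_quotient with
    finite := by
      have := h.finite
      infer_instance }

theorem IsGradedModule.isHomogeneousSubmodule_ker_X_pow (h : IsGradedModule d 𝓜) (i : Fin n)
    (k : ℕ) : IsHomogeneousSubmodule h
      (LinearMap.ker (LinearMap.lsmul (MvPolynomial (Fin n) F) M (X i ^ k))) := by
  intro x hx j
  simp only [LinearMap.mem_ker, LinearMap.lsmul_apply] at hx ⊢
  rw [← h.homogComponent_X_pow_smul, hx, map_zero]

theorem IsGradedModule.isHomogeneousSubmodule_X_smul_top (h : IsGradedModule d 𝓜) (i : Fin n) :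
    IsHomogeneousSubmodule h
      ((X i : MvPolynomial (Fin n) F) • (⊤ : Submodule (MvPolynomial (Fin n) F) M)) := by
  intro x hx j
  obtain ⟨y, -, rfl⟩ := hx
  have := h.homogComponent_X_pow_smul i 1 (j - d i) y
  simp only [Nat.cast_one, one_mul, pow_one, sub_add_cancel] at this
  exact ⟨_, trivial, this.symm⟩

end Modules

/-! ### Finiteness and Hilbert series of graded modules -/

section Finiteness

variable {F : Type u} [Field F] {n : ℕ} {d : Fin n → ℕ}
  {M : Type v} [AddCommGroup M] [Module F M] [Module (MvPolynomial (Fin n) F) M]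
  [IsScalarTower F (MvPolynomial (Fin n) F) M]
  {𝓜 : ℤ → Submodule F M}

/-- A finitely generated graded module is spanned, as a vector space, by the monomial multiples of
finitely many homogeneous elements. -/
theorem IsFGGradedModule.exists_homogeneous_generators (h : IsFGGradedModule d 𝓜) :
    ∃ G : Finset (ℤ × M), (∀ g ∈ G, g.2 ∈ 𝓜 g.1) ∧
      Submodule.span F {x | ∃ e : Fin n →₀ ℕ, ∃ g ∈ G, (monomial e (1 : F)) • g.2 = x} = ⊤ := by
  classical
  obtain ⟨S, hS⟩ := h.finite.fg_top
  choose s hs using exists_sum_homogComponent h.isInternal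
  let G : Finset (ℤ × M) :=
    S.biUnion fun x => (s x).image fun j => (j, homogComponent h.isInternal j x)
  refine ⟨G, ?_, ?_⟩
  · intro g hg
    simp only [G, Finset.mem_biUnion, Finset.mem_image] at hg
    obtain ⟨x, -, j, -, rfl⟩ := hg
    exact homogComponent_mem h.isInternal j x
  · have hG : Submodule.span (MvPolynomial (Fin n) F) (Prod.snd '' (G : Set (ℤ × M))) = ⊤ := by
      rw [eq_top_iff, ← hS, Submodule.span_le]
      intro x hx
      rw [← hs x]
      refine Submodule.sum_mem _ fun j hj => Submodule.subset_span ?_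
      refine ⟨(j, homogComponent h.isInternal j x), ?_, rfl⟩
      simp only [G, Finset.mem_coe, Finset.mem_biUnion, Finset.mem_image]
      exact ⟨x, hx, j, hj, rfl⟩
    have := Submodule.span_smul_of_span_eq_top (basisMonomials (Fin n) F).span_eq
      (Prod.snd '' (G : Set (ℤ × M)))
    rw [hG, Submodule.restrictScalars_top] at this
    rw [eq_top_iff, ← this]
    refine Submodule.span_mono ?_
    rintro _ ⟨_, ⟨e, rfl⟩, _, ⟨g, hg, rfl⟩, rfl⟩
    exact ⟨e, g, hg, by simp⟩

theorem weight_nonneg (e : Fin n →₀ ℕ) : 0 ≤ Finsupp.weight (fun i => (d i : ℤ)) e := by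
  rw [Finsupp.weight_apply]
  exact Finset.sum_nonneg fun i _ => by positivity

theorem le_weight (hd : ∀ i, 1 ≤ d i) (e : Fin n →₀ ℕ) (i : Fin n) :
    (e i : ℤ) ≤ Finsupp.weight (fun i => (d i : ℤ)) e := by
  rw [Finsupp.weight_apply, Finsupp.sum_fintype _ _ (by simp)]
  refine le_trans ?_ (Finset.single_le_sum (f := fun i => e i • (d i : ℤ))
    (fun i _ => by positivity) (Finset.mem_univ i))
  have := hd i
  simp only [nsmul_eq_mul]
  nlinarith [Nat.zero_le (e i)]

theorem finite_weight_le (hd : ∀ i, 1 ≤ d i) (k : ℤ) :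
    {e : Fin n →₀ ℕ | Finsupp.weight (fun i => (d i : ℤ)) e ≤ k}.Finite := by
  refine (Set.finite_Iic (Finsupp.equivFunOnFinite.symm fun _ => k.toNat)).subset ?_
  intro e he i
  have := (le_weight hd e i).trans he
  simp only [Finsupp.coe_equivFunOnFinite_symm]
  omega

omit [IsScalarTower F (MvPolynomial (Fin n) F) M] in
/-- The component of degree `j` is spanned by the monomial multiples of degree `j` of homogeneous
generators. -/
theorem IsGradedModule.component_eq_span (h : IsGradedModule d 𝓜) {G : Finset (ℤ × M)}
    (hG : ∀ g ∈ G, g.2 ∈ 𝓜 g.1)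
    (hspan : Submodule.span F {x | ∃ e : Fin n →₀ ℕ, ∃ g ∈ G, (monomial e (1 : F)) • g.2 = x} = ⊤)
    (j : ℤ) : 𝓜 j = Submodule.span F {x | ∃ e : Fin n →₀ ℕ, ∃ g ∈ G,
      Finsupp.weight (fun i => (d i : ℤ)) e + g.1 = j ∧ (monomial e (1 : F)) • g.2 = x} := by
  apply le_antisymm
  · intro x hx
    rw [← homogComponent_self h.isInternal hx]
    have hx' : x ∈ Submodule.span F
        {x | ∃ e : Fin n →₀ ℕ, ∃ g ∈ G, (monomial e (1 : F)) • g.2 = x} := by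
      rw [hspan]
      trivial
    clear hx
    induction hx' using Submodule.span_induction with
    | mem x hx =>
      obtain ⟨e, g, hg, rfl⟩ := hx
      rw [homogComponent_of_mem h.isInternal j (h.monomial_smul_mem (hG g hg) e 1)]
      split_ifs with hj
      · exact Submodule.subset_span ⟨e, g, hg, hj, rfl⟩
      · exact zero_mem _
    | zero => simp
    | add x y _ _ hx hy =>
      rw [map_add]
      exact add_mem hx hy
    | smul a x _ hx =>
      rw [map_smul]
      exact Submodule.smul_mem _ a hx
  · rw [Submodule.span_le]
    rintro _ ⟨e, g, hg, rfl, rfl⟩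
    exact h.monomial_smul_mem (hG g hg) e 1

theorem IsFGGradedModule.finiteDimensional (hd : ∀ i, 1 ≤ d i) (h : IsFGGradedModule d 𝓜)
    (j : ℤ) : FiniteDimensional F (𝓜 j) := by
  obtain ⟨G, hG, hspan⟩ := h.exists_homogeneous_generators
  rw [h.component_eq_span hG hspan j]
  refine FiniteDimensional.span_of_finite F ?_
  have hfin : (⋃ g ∈ G, (fun e : Fin n →₀ ℕ => (monomial e (1 : F)) • g.2) ''
      {e | Finsupp.weight (fun i => (d i : ℤ)) e ≤ j - g.1}).Finite :=
    G.finite_toSet.biUnion fun g _ => (finite_weight_le hd _).image _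
  refine hfin.subset ?_
  rintro _ ⟨e, g, hg, rfl, rfl⟩
  simp only [Set.mem_iUnion]
  exact ⟨g, hg, e, by simp, rfl⟩

theorem IsFGGradedModule.exists_forall_lt_eq_bot (h : IsFGGradedModule d 𝓜) :
    ∃ b, ∀ j < b, 𝓜 j = ⊥ := by
  obtain ⟨G, hG, hspan⟩ := h.exists_homogeneous_generators
  obtain ⟨b, hb⟩ := (G.finite_toSet.image Prod.fst).bddBelow
  refine ⟨b, fun j hj => ?_⟩
  rw [h.component_eq_span hG hspan j, Submodule.span_eq_bot]
  rintro _ ⟨e, g, hg, rfl, rfl⟩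
  have h1 := hb ⟨g, hg, rfl⟩
  have h2 := weight_nonneg (d := d) e
  omega

/-- If all variables act nilpotently on a finitely generated graded module, then it has finite
dimension, hence only finitely many components. -/
theorem IsFGGradedModule.finite_ne_bot (h : IsFGGradedModule d 𝓜)
    (hnil : ∀ i : Fin n, ∃ k : ℕ, ∀ x : M, (X i ^ k : MvPolynomial (Fin n) F) • x = 0) :
    {j | 𝓜 j ≠ ⊥}.Finite := by
  obtain ⟨G, hG, hspan⟩ := h.exists_homogeneous_generators
  choose k hk using hnil
  have hfin : {x : M | ∃ e : Fin n →₀ ℕ, ∃ g ∈ G, (monomial e (1 : F)) • g.2 = x}.Finite := by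
    have hfin : ((⋃ g ∈ G, (fun e : Fin n →₀ ℕ => (monomial e (1 : F)) • g.2) ''
        Set.Iic (Finsupp.equivFunOnFinite.symm k)) ∪ {0}).Finite :=
      (G.finite_toSet.biUnion fun g _ => (Set.finite_Iic _).image _).union (Set.finite_singleton 0)
    refine hfin.subset ?_
    rintro _ ⟨e, g, hg, rfl⟩
    by_cases he : e ≤ Finsupp.equivFunOnFinite.symm k
    · left
      simp only [Set.mem_iUnion]
      exact ⟨g, hg, e, he, rfl⟩
    · right
      obtain ⟨i, hi⟩ : ∃ i, k i ≤ e i := by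
        by_contra! hcon
        exact he fun i => (hcon i).le
      have : monomial e (1 : F) = monomial (e - Finsupp.single i (k i)) 1 * X i ^ k i := by
        rw [X_pow_eq_monomial, monomial_mul, one_mul, tsub_add_cancel_of_le]
        rwa [Finsupp.single_le_iff]
      rw [this, mul_smul, hk, smul_zero]
      rfl
  have : FiniteDimensional F M := ⟨⟨hfin.toFinset, by simpa using hspan⟩⟩
  exact WellFoundedGT.finite_ne_bot_of_iSupIndep h.isInternal.submodule_iSupIndep

omit [IsScalarTower F (MvPolynomial (Fin n) F) M] in
theorem IsGradedModule.exists_component_ne_bot [Nontrivial M] (h : IsGradedModule d 𝓜) :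
    ∃ j, 𝓜 j ≠ ⊥ := by
  by_contra! hcon
  have := h.isInternal.submodule_iSup_eq_top
  rw [iSup_eq_bot.mpr hcon] at this
  exact bot_ne_top this

/-- The graded version of Nakayama's lemma: `𝔪M ≠ M` for `M ≠ 0`. -/
theorem IsFGGradedModule.maxIdeal_smul_top_lt [Nontrivial M] (hd : ∀ i, 1 ≤ d i)
    (h : IsFGGradedModule d 𝓜) :
    maxIdeal F n • (⊤ : Submodule (MvPolynomial (Fin n) F) M) < ⊤ := by
  rw [lt_top_iff_ne_top]
  intro htop
  obtain ⟨b, hb⟩ := h.exists_forall_lt_eq_bot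
  -- `𝔪M` has no component in the lowest degree in which `M` is nonzero
  obtain ⟨j, hj, hmin⟩ := Int.exists_least_of_bdd (P := fun j => 𝓜 j ≠ ⊥)
    ⟨b, fun z hz => by
      by_contra hlt
      exact hz (hb z (by omega))⟩ h.exists_component_ne_bot
  apply hj
  have key : ∀ x ∈ maxIdeal F n • (⊤ : Submodule (MvPolynomial (Fin n) F) M),
      homogComponent h.isInternal j x = 0 := by
    intro x hx
    refine Submodule.smul_induction_on hx ?_ fun x y hx hy => by rw [map_add, hx, hy, add_zero]
    intro r hr y _
    induction hr using Submodule.span_induction generalizing y with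
    | mem r hr =>
      obtain ⟨i, rfl⟩ := hr
      have hc := h.homogComponent_X_pow_smul i 1 (j - d i) y
      simp only [Nat.cast_one, one_mul, pow_one, sub_add_cancel] at hc
      have hbot : 𝓜 (j - d i) = ⊥ := by
        by_contra hne
        have := hmin _ hne
        have := hd i
        omega
      have hmem := homogComponent_mem h.isInternal (j - d i) y
      rw [hbot, Submodule.mem_bot] at hmem
      rw [hc, hmem, smul_zero]
    | zero => simp
    | add r s _ _ hr hs => rw [add_smul, map_add, hr y trivial, hs y trivial, add_zero]
    | smul a r _ hr =>
      rw [smul_eq_mul, mul_comm, mul_smul]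
      exact hr _ trivial
  rw [eq_bot_iff]
  intro x hx
  have := key x (by rw [htop]; trivial)
  rwa [homogComponent_self h.isInternal hx] at this

/-- The socle of a finitely generated graded module with nilpotent action of the variables is
nonzero. -/
theorem IsFGGradedModule.subsingleton_of_socle_eq_zero (hd : ∀ i, 1 ≤ d i)
    (h : IsFGGradedModule d 𝓜)
    (hnil : ∀ i : Fin n, ∃ k : ℕ, ∀ x : M, (X i ^ k : MvPolynomial (Fin n) F) • x = 0)
    (hsoc : ∀ x : M, (∀ i, (X i : MvPolynomial (Fin n) F) • x = 0) → x = 0) : Subsingleton M := by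
  by_contra hM
  rw [not_subsingleton_iff_nontrivial] at hM
  obtain ⟨b, hb⟩ := (h.finite_ne_bot hnil).bddAbove
  -- the highest nonzero component lies in the socle
  obtain ⟨j, hj, hmax⟩ := Int.exists_greatest_of_bdd (P := fun j => 𝓜 j ≠ ⊥)
    ⟨b, fun z hz => hb hz⟩ h.exists_component_ne_bot
  apply hj
  rw [eq_bot_iff]
  intro x hx
  refine hsoc x fun i => ?_
  have h1 := h.X_smul_mem hx i
  have h2 : 𝓜 (j + d i) = ⊥ := by
    by_contra hne
    have := hmax _ hne
    have := hd i
    omega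
  rwa [h2] at h1

end Finiteness

section Hilbert

variable {F : Type u} [Field F] {n : ℕ} {d : Fin n → ℕ}
  {M : Type v} [AddCommGroup M] [Module F M] [Module (MvPolynomial (Fin n) F) M]
  {𝓜 : ℤ → Submodule F M}

theorem coeff_hilbertSeries (h : IsFGGradedModule d 𝓜) (j : ℤ) :
    (hilbertSeries h).coeff j = Module.finrank F (𝓜 j) := by
  simp [hilbertSeries, hilbertFunction]

variable [IsScalarTower F (MvPolynomial (Fin n) F) M]

theorem finrank_subGrading (U : Submodule (MvPolynomial (Fin n) F) M) (j : ℤ) :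
    Module.finrank F (subGrading 𝓜 U j) =
      Module.finrank F ↥(𝓜 j ⊓ U.restrictScalars F) := by
  have := Submodule.finrank_map_subtype_eq (U.restrictScalars F)
    ((𝓜 j).comap (U.restrictScalars F).subtype)
  rw [Submodule.map_comap_subtype, inf_comm] at this
  exact this.symm

/-- The Hilbert function is additive; finite dimension matters because `finrank` is zero on spaces
of infinite dimension. -/
theorem IsFGGradedModule.finrank_add (hd : ∀ i, 1 ≤ d i) (h : IsFGGradedModule d 𝓜)
    (U : Submodule (MvPolynomial (Fin n) F) M) (j : ℤ) :
    Module.finrank F (quotGrading 𝓜 U j) + Module.finrank F ↥(𝓜 j ⊓ U.restrictScalars F) =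
      Module.finrank F (𝓜 j) := by
  have := h.finiteDimensional hd j
  have key := LinearMap.finrank_range_add_finrank_ker
    ((U.mkQ.restrictScalars F).domRestrict (𝓜 j))
  rw [LinearMap.range_domRestrict, LinearMap.ker_domRestrict] at key
  rw [← key]
  congr 1
  rw [← Submodule.finrank_map_subtype_eq, Submodule.map_comap_subtype]
  have : (U.mkQ.restrictScalars F).ker = U.restrictScalars F := by
    ext x
    simp
  rw [this]

theorem IsFGGradedModule.hilbertSeries_add (hd : ∀ i, 1 ≤ d i) (h : IsFGGradedModule d 𝓜)
    {U : Submodule (MvPolynomial (Fin n) F) M} (hU : IsHomogeneousSubmodule h.toIsGradedModule U) :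
    hilbertSeries h = hilbertSeries (h.submodule hU) + hilbertSeries (h.quotient hU) := by
  ext j
  rw [HahnSeries.coeff_add, coeff_hilbertSeries, coeff_hilbertSeries, coeff_hilbertSeries,
    finrank_subGrading, ← h.finrank_add hd U j]
  push_cast
  ring

/-- The Hilbert series version of the exact sequence `0 → M(-d_i) → M → M / X_i M → 0`. -/
theorem IsFGGradedModule.hilbertSeries_mul_oneSubT (hd : ∀ i, 1 ≤ d i) (h : IsFGGradedModule d 𝓜)
    (i : Fin n) (hreg : IsSMulRegular M (X i : MvPolynomial (Fin n) F)) :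
    hilbertSeries h * oneSubT (d i) =
      hilbertSeries (h.quotient (h.isHomogeneousSubmodule_X_smul_top i)) := by
  ext j
  rw [oneSubT, mul_sub, mul_one, HahnSeries.coeff_sub, HahnSeries.coeff_mul_single,
    coeff_hilbertSeries, coeff_hilbertSeries, coeff_hilbertSeries,
    ← h.finrank_add hd ((X i : MvPolynomial (Fin n) F) •
      (⊤ : Submodule (MvPolynomial (Fin n) F) M)) j]
  let f : M →ₗ[F] M := Algebra.lsmul F F M (X i : MvPolynomial (Fin n) F)
  have hf : Function.Injective f := hreg
  have : 𝓜 j ⊓ ((X i : MvPolynomial (Fin n) F) •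
      (⊤ : Submodule (MvPolynomial (Fin n) F) M)).restrictScalars F = (𝓜 (j - d i)).map f := by
    ext x
    constructor
    · rintro ⟨hx, y, -, rfl⟩
      refine ⟨y, ?_, rfl⟩
      have hc := h.homogComponent_X_pow_smul i 1 (j - d i) y
      simp only [Nat.cast_one, one_mul, pow_one, sub_add_cancel] at hc
      have hx' : (X i : MvPolynomial (Fin n) F) • y ∈ 𝓜 j := hx
      rw [homogComponent_self h.isInternal hx'] at hc
      rw [hreg hc]
      exact homogComponent_mem h.isInternal _ _
    · rintro ⟨y, hy, rfl⟩
      refine ⟨?_, y, trivial, rfl⟩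
      have := h.X_smul_mem hy i
      rwa [sub_add_cancel] at this
  rw [this, ← (Submodule.equivMapOfInjective f hf (𝓜 (j - d i))).finrank_eq]
  push_cast
  ring

end Hilbert

/-! ### Existence of decompositions -/

section Series

theorem coeff_laurentPolynomialToSeries (Q : LaurentPolynomial ℤ) (k : ℤ) :
    (laurentPolynomialToSeries Q).coeff k = Q.coeff k := by
  classical
  rw [laurentPolynomialToSeries, Finsupp.sum, HahnSeries.coeff_sum]
  simp only [HahnSeries.coeff_single]
  rw [Finset.sum_eq_single k]
  · simp
  · intro b _ hb
    exact if_neg hb.symm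
  · simp

theorem laurentPolynomialToSeries_zero : laurentPolynomialToSeries 0 = 0 := by
  ext k
  simp [coeff_laurentPolynomialToSeries]

theorem laurentPolynomialToSeries_add (P Q : LaurentPolynomial ℤ) :
    laurentPolynomialToSeries (P + Q) =
      laurentPolynomialToSeries P + laurentPolynomialToSeries Q := by
  ext k
  simp [coeff_laurentPolynomialToSeries]

theorem isUnit_prod_oneSubT {n : ℕ} {d : Fin n → ℕ} (hd : ∀ i, 1 ≤ d i) (I : Finset (Fin n)) :
    IsUnit (∏ i ∈ I, oneSubT (d i)) := by
  induction I using Finset.induction_on with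
  | empty => simp
  | insert s I hs ih =>
    rw [Finset.prod_insert hs]
    exact (isUnit_oneSubT (hd s)).mul ih

theorem IsDecomposition.add {n : ℕ} {d : Fin n → ℕ} {H₁ H₂ : LaurentSeries ℤ}
    {Q₁ Q₂ : Finset (Fin n) → LaurentPolynomial ℤ} (h₁ : IsDecomposition d H₁ Q₁)
    (h₂ : IsDecomposition d H₂ Q₂) : IsDecomposition d (H₁ + H₂) (Q₁ + Q₂) := by
  refine ⟨fun I k => ?_, ?_⟩
  · simpa using add_nonneg (h₁.1 I k) (h₂.1 I k)
  · rw [h₁.2, h₂.2, ← Finset.sum_add_distrib]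
    refine Finset.sum_congr rfl fun I _ => ?_
    rw [Pi.add_apply, laurentPolynomialToSeries_add, add_mul]

/-- Dividing a decomposition by `1 - t^{d_s}` when no denominator involves `s`. -/
theorem IsDecomposition.of_mul_oneSubT {n : ℕ} {d : Fin n → ℕ} (hd : ∀ i, 1 ≤ d i) {s : Fin n}
    {H : LaurentSeries ℤ} {Q : Finset (Fin n) → LaurentPolynomial ℤ}
    (h : IsDecomposition d (H * oneSubT (d s)) Q) (hs : ∀ I, s ∈ I → Q I = 0) :
    IsDecomposition d H fun I => if s ∈ I then Q (I.erase s) else 0 := by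
  classical
  refine ⟨fun I k => ?_, ?_⟩
  · dsimp only
    split_ifs
    · exact h.1 _ k
    · simp
  · have hu := isUnit_oneSubT (hd s)
    have hH : H = H * oneSubT (d s) * Ring.inverse (oneSubT (d s)) := by
      rw [mul_assoc, Ring.mul_inverse_cancel _ hu, mul_one]
    rw [hH, h.2, Finset.sum_mul]
    have h1 : ∀ I : Finset (Fin n),
        laurentPolynomialToSeries (if s ∈ I then Q (I.erase s) else 0) *
          Ring.inverse (∏ i ∈ I, oneSubT (d i)) =
        if s ∈ I then laurentPolynomialToSeries (Q (I.erase s)) *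
          Ring.inverse (∏ i ∈ I, oneSubT (d i)) else 0 := by
      intro I
      split_ifs
      · rfl
      · rw [laurentPolynomialToSeries_zero, zero_mul]
    have h2 : ∀ I : Finset (Fin n), laurentPolynomialToSeries (Q I) *
          Ring.inverse (∏ i ∈ I, oneSubT (d i)) * Ring.inverse (oneSubT (d s)) =
        if s ∉ I then laurentPolynomialToSeries (Q I) *
          Ring.inverse (∏ i ∈ I, oneSubT (d i)) * Ring.inverse (oneSubT (d s)) else 0 := by
      intro I
      split_ifs with hI
      · rw [hs I hI, laurentPolynomialToSeries_zero, zero_mul, zero_mul]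
      · rfl
    rw [Finset.sum_congr rfl fun I _ => h1 I, Finset.sum_congr rfl fun I _ => h2 I,
      ← Finset.sum_filter, ← Finset.sum_filter]
    refine Finset.sum_nbij' (fun I => insert s I) (fun I => I.erase s) ?_ ?_ ?_ ?_ ?_
    · simp
    · simp
    · intro I hI
      simp only [Finset.mem_filter] at hI
      exact Finset.erase_insert hI.2
    · intro I hI
      simp only [Finset.mem_filter] at hI
      exact Finset.insert_erase hI.2
    · intro I hI
      simp only [Finset.mem_filter] at hI
      rw [Finset.erase_insert hI.2, Finset.prod_insert hI.2, mul_assoc, Ring.mul_inverse_rev]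

end Series

/-- A graded module with finitely many nonzero components has a Laurent polynomial with nonnegative
coefficients as its Hilbert series. -/
theorem IsFGGradedModule.exists_laurentPolynomial {F : Type u} [Field F] {n : ℕ} {d : Fin n → ℕ}
    {M : Type v} [AddCommGroup M] [Module F M] [Module (MvPolynomial (Fin n) F) M]
    {𝓜 : ℤ → Submodule F M} (h : IsFGGradedModule d 𝓜) (hfin : {j | 𝓜 j ≠ ⊥}.Finite) :
    ∃ q : LaurentPolynomial ℤ, (∀ k, q.coeff k = Module.finrank F (𝓜 k)) ∧
      laurentPolynomialToSeries q = hilbertSeries h := by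
  let q : LaurentPolynomial ℤ := AddMonoidAlgebra.ofCoeff
    (Finsupp.ofSupportFinite (fun k => (Module.finrank F (𝓜 k) : ℤ)) (hfin.subset fun k hk hbot =>
      hk (by dsimp only; rw [hbot, finrank_bot, Nat.cast_zero])))
  have hq : ∀ k, q.coeff k = Module.finrank F (𝓜 k) := fun k => rfl
  refine ⟨q, hq, ?_⟩
  ext k
  rw [coeff_laurentPolynomialToSeries, coeff_hilbertSeries, hq]

theorem smul_quotient_eq_zero {R : Type*} [CommRing R] {M : Type*} [AddCommGroup M] [Module R M]
    {r : R} (U : Submodule R M) (h : ∀ x : M, r • x = 0) (x : M ⧸ U) : r • x = 0 := by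
  obtain ⟨x, rfl⟩ := Submodule.Quotient.mk_surjective _ x
  rw [← Submodule.Quotient.mk_smul, h, Submodule.Quotient.mk_zero]

theorem smul_quotSMulTop_eq_zero {R : Type*} [CommRing R] {M : Type*} [AddCommGroup M] [Module R M]
    (r : R) (x : M ⧸ (r • ⊤ : Submodule R M)) : r • x = 0 := by
  obtain ⟨x, rfl⟩ := Submodule.Quotient.mk_surjective _ x
  rw [← Submodule.Quotient.mk_smul, Submodule.Quotient.mk_eq_zero]
  exact Submodule.smul_mem_pointwise_smul _ _ _ trivial

/-- The `X_s`-power torsion is killed by a single power of `X_s`, since `M` is noetherian. -/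
theorem IsFGGradedModule.exists_X_torsion {F : Type u} [Field F] {n : ℕ} {d : Fin n → ℕ}
    {M : Type v} [AddCommGroup M] [Module F M] [Module (MvPolynomial (Fin n) F) M]
    [IsScalarTower F (MvPolynomial (Fin n) F) M]
    {𝓜 : ℤ → Submodule F M} (h : IsFGGradedModule d 𝓜) (s : Fin n) :
    ∃ T : Submodule (MvPolynomial (Fin n) F) M, IsHomogeneousSubmodule h.toIsGradedModule T ∧
      (∃ k : ℕ, ∀ x ∈ T, (X s ^ k : MvPolynomial (Fin n) F) • x = 0) ∧
      IsSMulRegular (M ⧸ T) (X s : MvPolynomial (Fin n) F) := by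
  have := h.finite
  let K : ℕ →o Submodule (MvPolynomial (Fin n) F) M :=
    ⟨fun k => LinearMap.ker (LinearMap.lsmul (MvPolynomial (Fin n) F) M (X s ^ k)), by
      refine monotone_nat_of_le_succ fun k x hx => ?_
      simp only [LinearMap.mem_ker, LinearMap.lsmul_apply] at hx ⊢
      rw [pow_succ', mul_smul, hx, smul_zero]⟩
  obtain ⟨k, hk⟩ := monotone_stabilizes_iff_noetherian.mpr
    (inferInstance : IsNoetherian (MvPolynomial (Fin n) F) M) K
  refine ⟨K k, h.isHomogeneousSubmodule_ker_X_pow s k, ⟨k, fun x hx => hx⟩, ?_⟩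
  rw [isSMulRegular_quotient_iff_mem_of_smul_mem]
  intro x hx
  rw [hk (k + 1) k.le_succ]
  change (X s ^ (k + 1) : MvPolynomial (Fin n) F) • x = 0
  rw [pow_succ, mul_smul]
  exact hx

/-- The Hilbert series of a finitely generated graded module has a decomposition with nonnegative
numerators; if the module has zero socle, the numerator belonging to `∅` can be taken to be zero.
This is proved for modules on which all variables outside a set `S` act nilpotently, by induction
on `S`: for `s ∈ S` the `X_s`-power torsion `T` is a module for `S \ {s}`, and `X_s` is regular on
`M / T`, so that the Hilbert series of the latter is that of a module for `S \ {s}` divided by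
`1 - t^{d_s}`. -/
theorem exists_isDecomposition_of_nilpotent {F : Type u} [Field F] {n : ℕ} {d : Fin n → ℕ}
    (hd : ∀ i, 1 ≤ d i) (S : Finset (Fin n)) :
    ∀ (M : Type v) [AddCommGroup M] [Module F M] [Module (MvPolynomial (Fin n) F) M]
      [IsScalarTower F (MvPolynomial (Fin n) F) M] (𝓜 : ℤ → Submodule F M)
      (h : IsFGGradedModule d 𝓜),
      (∀ i ∉ S, ∃ k : ℕ, ∀ x : M, (X i ^ k : MvPolynomial (Fin n) F) • x = 0) →
      ∃ Q, IsDecomposition d (hilbertSeries h) Q ∧ (∀ I, ¬ I ⊆ S → Q I = 0) ∧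
        ((∀ x : M, (∀ i, (X i : MvPolynomial (Fin n) F) • x = 0) → x = 0) → Q ∅ = 0) := by
  classical
  induction S using Finset.induction_on with
  | empty =>
    intro M _ _ _ _ 𝓜 h hnil
    have hnil' : ∀ i : Fin n, ∃ k : ℕ, ∀ x : M, (X i ^ k : MvPolynomial (Fin n) F) • x = 0 :=
      fun i => hnil i (Finset.notMem_empty i)
    obtain ⟨q, hq, hqs⟩ := h.exists_laurentPolynomial (h.finite_ne_bot hnil')
    refine ⟨fun I => if I = ∅ then q else 0, ⟨fun I k => ?_, ?_⟩, fun I hI => ?_, fun hsoc => ?_⟩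
    · dsimp only
      split_ifs
      · rw [hq]
        positivity
      · simp
    · rw [Finset.sum_eq_single ∅]
      · simp [hqs]
      · intro I _ hI
        simp [hI, laurentPolynomialToSeries_zero]
      · simp
    · exact if_neg fun h => hI (by simp [h])
    · have := h.subsingleton_of_socle_eq_zero hd hnil' hsoc
      refine (if_pos rfl).trans ?_
      ext k
      rw [hq, Module.finrank_zero_of_subsingleton]
      rfl
  | insert s S hs ih =>
    intro M _ _ _ _ 𝓜 h hnil
    obtain ⟨T, hT, ⟨k, hk⟩, hreg⟩ := h.exists_X_torsion s
    have hQ := h.quotient hT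
    obtain ⟨Q₁, hQ₁, hsupp₁, hsoc₁⟩ := ih T _ (h.submodule hT) (by
      intro i hi
      by_cases his : i = s
      · subst his
        exact ⟨k, fun x => Subtype.ext (hk x x.2)⟩
      · obtain ⟨l, hl⟩ := hnil i (by simp [his, hi])
        exact ⟨l, fun x => Subtype.ext (hl x)⟩)
    obtain ⟨Q₂, hQ₂, hsupp₂, -⟩ := ih _ _
      (hQ.quotient (hQ.isHomogeneousSubmodule_X_smul_top s)) (by
      intro i hi
      by_cases his : i = s
      · subst his
        refine ⟨1, fun x => ?_⟩
        rw [pow_one]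
        exact smul_quotSMulTop_eq_zero _ x
      · obtain ⟨l, hl⟩ := hnil i (by simp [his, hi])
        exact ⟨l, smul_quotient_eq_zero _ (smul_quotient_eq_zero _ hl)⟩)
    rw [← hQ.hilbertSeries_mul_oneSubT hd s hreg] at hQ₂
    have hQ₂' := hQ₂.of_mul_oneSubT hd fun I hI => hsupp₂ I fun hsub => hs (hsub hI)
    have hsum := hQ₁.add hQ₂'
    rw [← h.hilbertSeries_add hd hT] at hsum
    refine ⟨_, hsum, fun I hI => ?_, fun hsoc => ?_⟩
    · rw [Pi.add_apply, hsupp₁ I fun hsub => hI (hsub.trans (Finset.subset_insert s S)), zero_add]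
      split_ifs with hsI
      · refine hsupp₂ _ fun hsub => hI ?_
        rwa [Finset.subset_insert_iff]
      · rfl
    · rw [Pi.add_apply, hsoc₁ ?_]
      · simp
      · intro x hx
        exact Subtype.ext (hsoc x fun i => congrArg Subtype.val (hx i))

theorem IsFGGradedModule.exists_isDecomposition {F : Type u} [Field F] {n : ℕ} {d : Fin n → ℕ}
    (hd : ∀ i, 1 ≤ d i) {M : Type v} [AddCommGroup M] [Module F M]
    [Module (MvPolynomial (Fin n) F) M] [IsScalarTower F (MvPolynomial (Fin n) F) M]
    {𝓜 : ℤ → Submodule F M} (h : IsFGGradedModule d 𝓜) :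
    ∃ Q, IsDecomposition d (hilbertSeries h) Q ∧
      ((∀ x : M, (∀ i, (X i : MvPolynomial (Fin n) F) • x = 0) → x = 0) → Q ∅ = 0) := by
  obtain ⟨Q, h1, -, h2⟩ := exists_isDecomposition_of_nilpotent hd Finset.univ M 𝓜 h (by simp)
  exact ⟨Q, h1, h2⟩

/-! ### Depth, associated primes and modules of maximal depth -/

section AssociatedPrimes

variable {R : Type*} [CommRing R] [IsNoetherianRing R]

theorem exists_mem_associatedPrimes_le {N : Type*} [AddCommGroup N] [Module R N]
    [Module.Finite R N] {p : PrimeSpectrum R} (hp : p ∈ Module.support R N) :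
    ∃ Q ∈ associatedPrimes R N, Q ≤ p.asIdeal := by
  obtain ⟨Q, hQ, hle⟩ := Ideal.exists_minimalPrimes_le (Module.annihilator_le_of_mem_support hp)
  exact ⟨Q, Module.associatedPrimes.minimalPrimes_annihilator_subset_associatedPrimes R N hQ, hle⟩

theorem annihilator_le_of_mem_associatedPrimes {N : Type*} [AddCommGroup N] [Module R N]
    {P : Ideal R} (hP : P ∈ associatedPrimes R N) : Module.annihilator R N ≤ P := by
  obtain ⟨-, a, rfl⟩ := Submodule.isAssociatedPrime_iff.mp hP
  intro r hr
  rw [Submodule.mem_colon_singleton, Submodule.mem_bot]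
  exact Module.mem_annihilator.mp hr a

theorem notMem_of_mem_associatedPrimes {N : Type*} [AddCommGroup N] [Module R N]
    {P : Ideal R} (hP : P ∈ associatedPrimes R N) {x : R} (hx : IsSMulRegular N x) : x ∉ P := by
  intro hxP
  have := Set.mem_biUnion (t := fun p : Ideal R => (p : Set R)) hP hxP
  rw [biUnion_associatedPrimes_eq_compl_regular] at this
  exact this hx

/-- Passing from `N` to `N / xN` for a regular element `x`, associated primes grow: the submodule
`L` of all elements killed by `P` satisfies `L ∩ xN = xL`, so that `L / xL` embeds into `N / xN`. -/
theorem exists_mem_associatedPrimes_quotSMulTop {N : Type*} [AddCommGroup N] [Module R N]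
    [Module.Finite R N] {m P : Ideal R} [m.IsPrime] (hP : P ∈ associatedPrimes R N) (hPm : P ≤ m)
    {x : R} (hxm : x ∈ m) (hx : IsSMulRegular N x) :
    ∃ Q ∈ associatedPrimes R (QuotSMulTop x N), P ≤ Q ∧ x ∈ Q ∧ Q ≤ m := by
  let L : Submodule R N := Submodule.torsionBySet R N P
  have hL : ∀ y, y ∈ L ↔ ∀ p ∈ P, p • y = 0 := fun y => by simp [L, Submodule.mem_torsionBySet_iff]
  have hsupp : (⟨m, inferInstance⟩ : PrimeSpectrum R) ∈ Module.support R L := by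
    obtain ⟨-, a, ha⟩ := Submodule.isAssociatedPrime_iff.mp hP
    have hap : ∀ r, r ∈ P ↔ r • a = 0 := fun r => by
      rw [ha, Submodule.mem_colon_singleton, Submodule.mem_bot]
    rw [Module.mem_support_iff_exists_annihilator]
    refine ⟨⟨a, (hL a).2 fun p hp => (hap p).1 hp⟩, fun r hr => hPm ((hap r).2 ?_)⟩
    rw [Submodule.mem_annihilator_span_singleton] at hr
    exact congrArg Subtype.val hr
  have hsupp' : (⟨m, inferInstance⟩ : PrimeSpectrum R) ∈ Module.support R (QuotSMulTop x L) := by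
    rw [Module.support_quotSMulTop]
    exact ⟨hsupp, by simpa [PrimeSpectrum.mem_zeroLocus] using hxm⟩
  obtain ⟨Q, hQ, hQm⟩ := exists_mem_associatedPrimes_le hsupp'
  have hann := annihilator_le_of_mem_associatedPrimes hQ
  have hinj : Function.Injective (QuotSMulTop.map x L.subtype) := by
    rw [← LinearMap.ker_eq_bot, LinearMap.ker_eq_bot']
    intro y hy
    obtain ⟨y, rfl⟩ := Submodule.Quotient.mk_surjective _ y
    rw [QuotSMulTop.map_apply_mk, Submodule.Quotient.mk_eq_zero] at hy
    obtain ⟨b, -, hb⟩ := hy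
    have hb' : x • b = y := hb
    have hbL : b ∈ L := by
      rw [hL]
      intro p hp
      apply hx
      change x • p • b = x • 0
      rw [smul_comm, hb', smul_zero]
      exact (hL y).1 y.2 p hp
    rw [Submodule.Quotient.mk_eq_zero]
    exact ⟨⟨b, hbL⟩, trivial, Subtype.ext hb⟩
  refine ⟨Q, associatedPrimes.subset_of_injective hinj hQ, fun p hp => hann ?_, hann ?_, hQm⟩
  · rw [Module.mem_annihilator]
    refine smul_quotient_eq_zero _ fun y => Subtype.ext ?_
    exact (hL y).1 y.2 p hp
  · rw [Module.mem_annihilator]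
    exact smul_quotSMulTop_eq_zero x

/-- The length of a weakly regular sequence in a prime ideal `m` is at most the dimension of `R / P`
for every associated prime `P` which is contained in `m`. -/
theorem length_le_ringKrullDim_quotient {m : Ideal R} [m.IsPrime] (rs : List R) :
    ∀ {N : Type v} [AddCommGroup N] [Module R N] [Module.Finite R N] {P : Ideal R},
      P ∈ associatedPrimes R N → P ≤ m → (∀ r ∈ rs, r ∈ m) → IsWeaklyRegular N rs →
      (rs.length : WithBot ℕ∞) ≤ ringKrullDim (R ⧸ P) := by
  induction rs with
  | nil =>
    intro N _ _ _ P hP _ _ _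
    have := hP.isPrime
    simpa using ringKrullDim_nonneg_of_nontrivial
  | cons x rs ih =>
    intro N _ _ _ P hP hPm hrs hreg
    rw [isWeaklyRegular_cons_iff] at hreg
    obtain ⟨Q, hQ, hPQ, hxQ, hQm⟩ := exists_mem_associatedPrimes_quotSMulTop hP hPm
      (hrs x List.mem_cons_self) hreg.1
    have := hP.isPrime
    have hle := ih hQ hQm (fun r hr => hrs r (List.mem_cons_of_mem _ hr)) hreg.2
    have hsucc := ringKrullDim_succ_le_of_surjective (Ideal.Quotient.factor hPQ)
      (Ideal.Quotient.factor_surjective hPQ) (r := Ideal.Quotient.mk P x)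
      (mem_nonZeroDivisors_of_ne_zero
        (mt Ideal.Quotient.eq_zero_iff_mem.mp (notMem_of_mem_associatedPrimes hP hreg.1)))
      (by rwa [Ideal.Quotient.factor_mk, Ideal.Quotient.eq_zero_iff_mem])
    refine le_trans ?_ hsucc
    push_cast [List.length_cons]
    gcongr

end AssociatedPrimes

open CategoryTheory Abelian in
/-- Dividing out a regular element of `I` shortens the regular sequences in `I` by at most one; this
is a consequence of Rees' characterization of depth in terms of `Ext`. -/
theorem exists_isRegular_quotSMulTop {R : Type u} [CommRing R] [IsNoetherianRing R] {I : Ideal R}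
    {N : Type u} [AddCommGroup N] [Module R N] [Module.Finite R N]
    (hN : I • (⊤ : Submodule R N) < ⊤) {x : R} (hx : IsSMulRegular N x)
    (hNx : I • (⊤ : Submodule R (QuotSMulTop x N)) < ⊤) {k : ℕ}
    (h : ∃ rs : List R, rs.length = k + 1 ∧ (∀ r ∈ rs, r ∈ I) ∧ IsRegular N rs) :
    ∃ rs : List R, rs.length = k ∧ (∀ r ∈ rs, r ∈ I) ∧ IsRegular (QuotSMulTop x N) rs := by
  have h1 := ((ModuleCat.exists_isRegular_tfae I (k + 1) (ModuleCat.of R N) hN).out 3 1).mp h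
  refine ((ModuleCat.exists_isRegular_tfae I k (ModuleCat.of R (QuotSMulTop x N)) hNx).out 3 1).mpr
    fun i hi => ?_
  have zero1 := AddCommGrpCat.isZero_of_iff_subsingleton.mpr (h1 i (by omega))
  have zero2 := AddCommGrpCat.isZero_of_iff_subsingleton.mpr (h1 (i + 1) (by omega))
  have hx' : IsSMulRegular (ModuleCat.of R N) x := hx
  exact AddCommGrpCat.subsingleton_of_isZero <| ShortComplex.Exact.isZero_of_both_zeros
    ((Ext.covariant_sequence_exact₃' _ hx'.smulShortComplex_shortExact) i (i + 1) rfl)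
    (zero1.eq_zero_of_src _) (zero2.eq_zero_of_tgt _)

section Polynomial

variable {F : Type u} [Field F] {n : ℕ} {d : Fin n → ℕ}

theorem isMaximal_maxIdeal : (maxIdeal F n).IsMaximal := by
  have : maxIdeal F n = RingHom.ker (constantCoeff : MvPolynomial (Fin n) F →+* F) := by
    ext p
    rw [maxIdeal, ← Set.image_univ, mem_ideal_span_X_image, RingHom.mem_ker]
    constructor
    · intro h
      by_contra hne
      obtain ⟨i, -, hi⟩ := h 0 (mem_support_iff.mpr hne)
      exact hi rfl
    · intro h m hm
      by_contra! hcon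
      have : m = 0 := Finsupp.ext fun i => hcon i trivial
      exact mem_support_iff.mp hm (this ▸ h)
  rw [this]
  exact RingHom.ker_isMaximal_of_surjective _ fun a => ⟨C a, constantCoeff_C _ a⟩

theorem IsFGGradedModule.exists_mem_associatedPrimes {M : Type v} [AddCommGroup M] [Nontrivial M]
    [Module F M] [Module (MvPolynomial (Fin n) F) M] [IsScalarTower F (MvPolynomial (Fin n) F) M]
    {𝓜 : ℤ → Submodule F M} (hd : ∀ i, 1 ≤ d i) (h : IsFGGradedModule d 𝓜) :
    ∃ P ∈ associatedPrimes (MvPolynomial (Fin n) F) M, P ≤ maxIdeal F n := by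
  have := h.finite
  have hlt := h.maxIdeal_smul_top_lt hd
  have : Nontrivial (M ⧸ maxIdeal F n • (⊤ : Submodule (MvPolynomial (Fin n) F) M)) :=
    Submodule.Quotient.nontrivial_iff.mpr hlt.ne
  obtain ⟨q, hq⟩ := Module.nonempty_support_of_nontrivial (R := MvPolynomial (Fin n) F)
    (M := M ⧸ maxIdeal F n • (⊤ : Submodule (MvPolynomial (Fin n) F) M))
  rw [Module.support_quotient] at hq
  obtain ⟨P, hP, hPq⟩ := exists_mem_associatedPrimes_le hq.1
  rw [← isMaximal_maxIdeal.eq_of_le q.isPrime.ne_top hq.2] at hPq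
  exact ⟨P, hP, hPq⟩

theorem ringKrullDim_quotient_le_card {P : Ideal (MvPolynomial (Fin n) F)} {S : Finset (Fin n)}
    (hP : ∀ i ∉ S, X i ∈ P) : ringKrullDim (MvPolynomial (Fin n) F ⧸ P) ≤ S.card := by
  let f : MvPolynomial S F →ₐ[F] MvPolynomial (Fin n) F ⧸ P :=
    (Ideal.Quotient.mkₐ F P).comp (rename Subtype.val)
  have hf : Function.Surjective f := by
    intro y
    obtain ⟨p, rfl⟩ := Ideal.Quotient.mk_surjective y
    induction p using MvPolynomial.induction_on with
    | C a => exact ⟨C a, by simp [f]; rfl⟩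
    | add p q hp hq =>
      obtain ⟨a, ha⟩ := hp
      obtain ⟨b, hb⟩ := hq
      exact ⟨a + b, by rw [map_add, map_add, ha, hb]⟩
    | mul_X p i hp =>
      obtain ⟨a, ha⟩ := hp
      by_cases hi : i ∈ S
      · exact ⟨a * X ⟨i, hi⟩, by rw [map_mul, map_mul, ha]; simp [f]⟩
      · refine ⟨0, ?_⟩
        rw [map_zero, eq_comm, Ideal.Quotient.eq_zero_iff_mem]
        exact Ideal.mul_mem_left _ _ (hP i hi)
  refine (ringKrullDim_le_of_surjective f.toRingHom hf).trans ?_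
  rw [MvPolynomial.ringKrullDim_of_isNoetherianRing]
  simp

theorem IsFGGradedModule.length_le {M : Type v} [AddCommGroup M]
    [Module F M] [Module (MvPolynomial (Fin n) F) M] [IsScalarTower F (MvPolynomial (Fin n) F) M]
    {𝓜 : ℤ → Submodule F M} (hd : ∀ i, 1 ≤ d i) (h : IsFGGradedModule d 𝓜)
    {rs : List (MvPolynomial (Fin n) F)} (hrs : ∀ r ∈ rs, r ∈ maxIdeal F n)
    (hreg : IsRegular M rs) : rs.length ≤ n := by
  have := hreg.nontrivial
  have := h.finite
  have := (isMaximal_maxIdeal (F := F) (n := n)).isPrime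
  obtain ⟨P, hP, hPm⟩ := h.exists_mem_associatedPrimes hd
  have h1 := length_le_ringKrullDim_quotient rs hP hPm hrs hreg.toIsWeaklyRegular
  have h2 := ringKrullDim_quotient_le_card (P := P) (S := Finset.univ) (by simp)
  have := h1.trans h2
  simpa using this

theorem IsFGGradedModule.depth_le {M : Type v} [AddCommGroup M]
    [Module F M] [Module (MvPolynomial (Fin n) F) M] [IsScalarTower F (MvPolynomial (Fin n) F) M]
    {𝓜 : ℤ → Submodule F M} (hd : ∀ i, 1 ≤ d i) (h : IsFGGradedModule d 𝓜) :
    depth F n M ≤ n :=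
  iSup_le fun rs => by exact_mod_cast h.length_le hd rs.2.1 rs.2.2

/-- A module on which the variables outside `S` act as zero and which has a regular sequence of
length `|S|` in `𝔪` has the Hilbert series of a free module over the polynomial ring in the
variables of `S`. If some `X_s`, `s ∈ S`, were not regular, then the kernel of multiplication by
`X_s` would provide an associated prime of dimension less than `|S|`. -/
theorem exists_hilbertSeries_mul_prod_eq (hd : ∀ i, 1 ≤ d i) (S : Finset (Fin n)) :
    ∀ (N : Type u) [AddCommGroup N] [Module F N] [Module (MvPolynomial (Fin n) F) N]
      [IsScalarTower F (MvPolynomial (Fin n) F) N] (𝓝 : ℤ → Submodule F N)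
      (h : IsFGGradedModule d 𝓝),
      (∀ i ∉ S, ∀ x : N, (X i : MvPolynomial (Fin n) F) • x = 0) →
      (∃ rs : List (MvPolynomial (Fin n) F), rs.length = S.card ∧ (∀ r ∈ rs, r ∈ maxIdeal F n) ∧
        IsRegular N rs) →
      ∃ q : LaurentPolynomial ℤ, (∀ k, 0 ≤ q.coeff k) ∧
        hilbertSeries h * ∏ i ∈ S, oneSubT (d i) = laurentPolynomialToSeries q := by
  classical
  induction S using Finset.induction_on with
  | empty =>
    intro N _ _ _ _ 𝓝 h hS _
    obtain ⟨q, hq, hqs⟩ := h.exists_laurentPolynomial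
      (h.finite_ne_bot fun i => ⟨1, by simpa using hS i (Finset.notMem_empty i)⟩)
    refine ⟨q, fun k => ?_, by simp [hqs]⟩
    rw [hq]
    positivity
  | insert s S hs ih =>
    intro N _ _ _ _ 𝓝 h hS hrs
    have := h.finite
    have := (isMaximal_maxIdeal (F := F) (n := n)).isPrime
    obtain ⟨rs, hlen, hmem, hreg⟩ := hrs
    rw [Finset.card_insert_of_notMem hs] at hlen
    have := hreg.nontrivial
    have hXs : IsSMulRegular N (X s : MvPolynomial (Fin n) F) := by
      by_contra hns
      let T := LinearMap.ker (LinearMap.lsmul (MvPolynomial (Fin n) F) N (X s ^ 1))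
      have hTs : ∀ x : T, (X s : MvPolynomial (Fin n) F) • x = 0 := fun x => by
        have := x.2
        rw [LinearMap.mem_ker, LinearMap.lsmul_apply, pow_one] at this
        exact Subtype.ext this
      have hTne : Nontrivial T := by
        rw [Submodule.nontrivial_iff_ne_bot, Ne, LinearMap.ker_eq_bot]
        intro hinj
        rw [pow_one] at hinj
        exact hns hinj
      obtain ⟨P, hP, hPm⟩ := (h.submodule
        (h.isHomogeneousSubmodule_ker_X_pow s 1)).exists_mem_associatedPrimes hd
      have hann := annihilator_le_of_mem_associatedPrimes hP
      have h1 := length_le_ringKrullDim_quotient rs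
        (associatedPrimes.subset_of_injective T.subtype_injective hP) hPm hmem
        hreg.toIsWeaklyRegular
      have h2 : ringKrullDim (MvPolynomial (Fin n) F ⧸ P) ≤ S.card := by
        refine ringKrullDim_quotient_le_card fun i hi => hann ?_
        rw [Module.mem_annihilator]
        by_cases his : i = s
        · rw [his]
          exact hTs
        · exact fun x => Subtype.ext (hS i (by simp [his, hi]) x)
      have h3 := h1.trans h2
      rw [hlen] at h3
      have h4 : S.card + 1 ≤ S.card := by exact_mod_cast h3
      omega
    have hQ := h.quotient (h.isHomogeneousSubmodule_X_smul_top s)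
    have hX : (X s : MvPolynomial (Fin n) F) ∈ maxIdeal F n := Ideal.subset_span ⟨s, rfl⟩
    have hlt := h.maxIdeal_smul_top_lt hd
    have : Nontrivial (QuotSMulTop (X s : MvPolynomial (Fin n) F) N) := by
      refine Submodule.Quotient.nontrivial_iff.mpr (ne_top_of_le_ne_top hlt.ne ?_)
      rw [← Submodule.ideal_span_singleton_smul]
      exact Submodule.smul_mono_left ((Ideal.span_singleton_le_iff_mem _).mpr hX)
    obtain ⟨q, hq, hqs⟩ := ih _ _ hQ (by
      intro i hi
      by_cases his : i = s
      · rw [his]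
        exact smul_quotSMulTop_eq_zero _
      · exact smul_quotient_eq_zero _ (hS i (by simp [his, hi])))
      (exists_isRegular_quotSMulTop hlt hXs (hQ.maxIdeal_smul_top_lt hd) ⟨rs, hlen, hmem, hreg⟩)
    refine ⟨q, hq, ?_⟩
    rw [Finset.prod_insert hs, ← mul_assoc, h.hilbertSeries_mul_oneSubT hd s hXs, hqs]

end Polynomial

/-! ### Coordinate subspaces and direct sums -/

section Face

variable {F : Type u} [Field F] {n : ℕ} {d : Fin n → ℕ}

variable (F) in
/-- The endomorphism of `F[X_1, …, X_n]` which sends the variables outside `I` to zero. -/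
noncomputable def faceMap (I : Finset (Fin n)) :
    MvPolynomial (Fin n) F →ₐ[F] MvPolynomial (Fin n) F :=
  aeval fun i => if i ∈ I then X i else 0

theorem faceMap_monomial_of_forall_notMem {I : Finset (Fin n)} {m : Fin n →₀ ℕ}
    (hm : ∀ i ∉ I, m i = 0) (a : F) : faceMap F I (monomial m a) = monomial m a := by
  rw [faceMap, aeval_monomial, monomial_eq]
  congr 1
  refine Finset.prod_congr rfl fun i hi => ?_
  by_cases hiI : i ∈ I
  · simp [hiI]
  · exact absurd (hm i hiI) (Finsupp.mem_support_iff.mp hi)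

theorem faceMap_monomial_of_notMem {I : Finset (Fin n)} {m : Fin n →₀ ℕ} {i : Fin n}
    (hi : i ∉ I) (hm : m i ≠ 0) (a : F) : faceMap F I (monomial m a) = 0 := by
  rw [faceMap, aeval_monomial, Finsupp.prod,
    Finset.prod_eq_zero (Finsupp.mem_support_iff.mpr hm) (by simp [hi, hm]), mul_zero]

theorem faceMap_faceMap (I : Finset (Fin n)) (p : MvPolynomial (Fin n) F) :
    faceMap F I (faceMap F I p) = faceMap F I p := by
  have : (faceMap F I).comp (faceMap F I) = faceMap F I := by
    ext i : 1
    by_cases hi : i ∈ I <;> simp [faceMap, hi]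
  exact DFunLike.congr_fun this p

/-- `F[X_1, …, X_n]` is a graded module over itself. -/
theorem isGradedModule_mvPolynomial : IsGradedModule d
    (M := MvPolynomial (Fin n) F) (weightedHomogeneousSubmodule F fun i => (d i : ℤ)) where
  isInternal := by
    let _ := weightedGradedAlgebra F fun i : Fin n => (d i : ℤ)
    exact DirectSum.Decomposition.isInternal _
  gradedSMul := ⟨fun {_ _ _ _} ha hb => IsWeightedHomogeneous.mul ha hb⟩

theorem isFGGradedModule_mvPolynomial : IsFGGradedModule d
    (M := MvPolynomial (Fin n) F) (weightedHomogeneousSubmodule F fun i => (d i : ℤ)) :=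
  { isGradedModule_mvPolynomial with finite := inferInstance }

/-- The exponents of the monomials of degree `j` in the variables of `I`. -/
def faceExponents (d : Fin n → ℕ) (I : Finset (Fin n)) (j : ℤ) : Set (Fin n →₀ ℕ) :=
  {m | (∀ i ∉ I, m i = 0) ∧ Finsupp.weight (fun i => (d i : ℤ)) m = j}

theorem finite_faceExponents (hd : ∀ i, 1 ≤ d i) (I : Finset (Fin n)) (j : ℤ) :
    (faceExponents d I j).Finite :=
  (finite_weight_le hd j).subset fun _ hm => hm.2.le

theorem map_faceMap (I : Finset (Fin n)) (j : ℤ) :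
    (weightedHomogeneousSubmodule F (fun i => (d i : ℤ)) j).map (faceMap F I).toLinearMap =
      Submodule.span F
        (Set.range fun m : faceExponents d I j => monomial (m : Fin n →₀ ℕ) (1 : F)) := by
  apply le_antisymm
  · rintro _ ⟨p, hp, rfl⟩
    rw [p.as_sum, map_sum]
    refine Submodule.sum_mem _ fun m hm => ?_
    have hw := hp (mem_support_iff.mp hm)
    by_cases hmI : ∀ i ∉ I, m i = 0
    · rw [AlgHom.toLinearMap_apply, faceMap_monomial_of_forall_notMem hmI]
      have : monomial m (coeff m p) = coeff m p • monomial m (1 : F) := by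
        rw [smul_monomial, smul_eq_mul, mul_one]
      rw [this]
      exact Submodule.smul_mem _ _ (Submodule.subset_span ⟨⟨m, hmI, hw⟩, rfl⟩)
    · push Not at hmI
      obtain ⟨i, hi, hmi⟩ := hmI
      rw [AlgHom.toLinearMap_apply, faceMap_monomial_of_notMem hi hmi]
      exact zero_mem _
  · rw [Submodule.span_le]
    rintro _ ⟨⟨m, hmI, hw⟩, rfl⟩
    exact ⟨monomial m 1, isWeightedHomogeneous_monomial _ _ _ hw,
      faceMap_monomial_of_forall_notMem hmI 1⟩

theorem faceMap_mem {I : Finset (Fin n)} {j : ℤ} {p : MvPolynomial (Fin n) F}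
    (hp : p ∈ weightedHomogeneousSubmodule F (fun i => (d i : ℤ)) j) :
    faceMap F I p ∈ weightedHomogeneousSubmodule F (fun i => (d i : ℤ)) j := by
  have h : faceMap F I p ∈ (weightedHomogeneousSubmodule F (fun i => (d i : ℤ)) j).map
      (faceMap F I).toLinearMap := ⟨p, hp, rfl⟩
  rw [map_faceMap] at h
  refine Submodule.span_le.mpr ?_ h
  rintro _ ⟨⟨m, hmI, hw⟩, rfl⟩
  exact isWeightedHomogeneous_monomial _ _ _ hw

variable (F) in
/-- The ideal `(X_i : i ∉ I)`, as the kernel of `faceMap F I`. -/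
noncomputable def faceIdeal (I : Finset (Fin n)) :
    Submodule (MvPolynomial (Fin n) F) (MvPolynomial (Fin n) F) :=
  RingHom.ker (faceMap F I)

theorem mem_faceIdeal {I : Finset (Fin n)} {p : MvPolynomial (Fin n) F} :
    p ∈ faceIdeal F I ↔ faceMap F I p = 0 := Iff.rfl

theorem isHomogeneousSubmodule_faceIdeal (I : Finset (Fin n)) :
    IsHomogeneousSubmodule (isGradedModule_mvPolynomial (F := F) (d := d)) (faceIdeal F I) := by
  intro p hp j
  rw [mem_faceIdeal] at hp ⊢
  have hint := (isGradedModule_mvPolynomial (F := F) (d := d)).isInternal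
  have := map_homogComponent hint hint 0 (faceMap F I).toLinearMap
    (fun j p hp => by simpa using faceMap_mem hp) j p
  rw [add_zero, AlgHom.toLinearMap_apply, AlgHom.toLinearMap_apply, hp, map_zero] at this
  exact this.symm

theorem finrank_quotGrading_faceIdeal (hd : ∀ i, 1 ≤ d i) (I : Finset (Fin n)) (j : ℤ) :
    Module.finrank F (quotGrading (weightedHomogeneousSubmodule F fun i => (d i : ℤ))
      (faceIdeal F I) j) = (faceExponents d I j).ncard := by
  have h := isFGGradedModule_mvPolynomial (F := F) (d := d)
  have hfin := h.finiteDimensional hd j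
  have := (finite_faceExponents hd I j).fintype
  have hli : LinearIndependent F
      fun m : faceExponents d I j => monomial (m : Fin n →₀ ℕ) (1 : F) := by
    have := (basisMonomials (Fin n) F).linearIndependent.comp
      (fun m : faceExponents d I j => (m : Fin n →₀ ℕ)) Subtype.val_injective
    rwa [coe_basisMonomials] at this
  -- reduction modulo the ideal and `faceMap F I` have the same kernel, hence images of the same
  -- dimension
  have key := LinearMap.finrank_range_add_finrank_ker ((faceMap F I).toLinearMap.domRestrict
    (weightedHomogeneousSubmodule F (fun i => (d i : ℤ)) j))
  have hker : (faceMap F I).toLinearMap.ker = (faceIdeal F I).restrictScalars F := rfl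
  rw [LinearMap.range_domRestrict, LinearMap.ker_domRestrict, map_faceMap, finrank_span_eq_card hli,
    ← Nat.card_eq_fintype_card, Nat.card_coe_set_eq, ← Submodule.finrank_map_subtype_eq,
    Submodule.map_comap_subtype, hker, ← h.finrank_add hd (faceIdeal F I) j] at key
  omega

theorem ncard_faceExponents_insert (hd : ∀ i, 1 ≤ d i) {I : Finset (Fin n)} {s : Fin n}
    (hs : s ∉ I) (j : ℤ) : (faceExponents d (insert s I) j).ncard =
      (faceExponents d I j).ncard + (faceExponents d (insert s I) (j - d s)).ncard := by
  have hinj : Function.Injective fun m : Fin n →₀ ℕ => m + Finsupp.single s 1 :=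
    add_left_injective _
  have hunion : faceExponents d (insert s I) j = faceExponents d I j ∪
      (fun m => m + Finsupp.single s 1) '' faceExponents d (insert s I) (j - d s) := by
    ext m
    constructor
    · rintro ⟨hm, hw⟩
      by_cases hms : m s = 0
      · refine Or.inl ⟨fun i hi => ?_, hw⟩
        by_cases his : i = s
        · rwa [his]
        · exact hm i (by simp [his, hi])
      · have hle : Finsupp.single s 1 ≤ m := by
          rw [Finsupp.single_le_iff]
          omega
        refine Or.inr ⟨m - Finsupp.single s 1, ⟨fun i hi => ?_, ?_⟩, tsub_add_cancel_of_le hle⟩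
        · simp [hm i hi]
        · have := congrArg (Finsupp.weight fun i => (d i : ℤ)) (tsub_add_cancel_of_le hle)
          rw [map_add, Finsupp.weight_single, one_smul] at this
          linarith
    · rintro (⟨hm, hw⟩ | ⟨m, ⟨hm, hw⟩, rfl⟩)
      · exact ⟨fun i hi => hm i fun h => hi (Finset.mem_insert_of_mem h), hw⟩
      · refine ⟨fun i hi => ?_, ?_⟩
        · have : s ≠ i := fun h => hi (by simp [h])
          simp [hm i hi, this]
        · rw [map_add, Finsupp.weight_single, one_smul, hw, sub_add_cancel]
  rw [hunion, Set.ncard_union_eq ?_ (finite_faceExponents hd _ _)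
    ((finite_faceExponents hd _ _).image _), Set.ncard_image_of_injective _ hinj]
  rw [Set.disjoint_left]
  rintro _ hm ⟨m, -, rfl⟩
  have := hm.1 s hs
  simp at this

theorem bddBelow_support_ncard_faceExponents (d : Fin n → ℕ) (I : Finset (Fin n)) :
    BddBelow (Function.support fun j => ((faceExponents d I j).ncard : ℤ)) := by
  refine ⟨0, fun j hj => ?_⟩
  obtain ⟨m, -, hm⟩ := Set.nonempty_of_ncard_ne_zero (s := faceExponents d I j)
    fun h => hj (by simp [h])
  rw [← hm]
  exact weight_nonneg m

/-- The Hilbert series of `F[X_i : i ∈ I]`, counting monomials. -/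
theorem ofSuppBddBelow_ncard_faceExponents (hd : ∀ i, 1 ≤ d i) (I : Finset (Fin n)) :
    HahnSeries.ofSuppBddBelow _ (bddBelow_support_ncard_faceExponents d I) =
      Ring.inverse (∏ i ∈ I, oneSubT (d i)) := by
  suffices h : HahnSeries.ofSuppBddBelow _ (bddBelow_support_ncard_faceExponents d I) *
      ∏ i ∈ I, oneSubT (d i) = 1 by
    rw [← mul_one (HahnSeries.ofSuppBddBelow _ _),
      ← Ring.mul_inverse_cancel _ (isUnit_prod_oneSubT hd I), ← mul_assoc, h, one_mul]
  induction I using Finset.induction_on with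
  | empty =>
    rw [Finset.prod_empty, mul_one]
    ext j
    rw [HahnSeries.coeff_ofSuppBddBelow, HahnSeries.coeff_one]
    have : faceExponents d ∅ j = if j = 0 then {0} else ∅ := by
      ext m
      have hm : (∀ i ∉ (∅ : Finset (Fin n)), m i = 0) ↔ m = 0 := by
        simp [Finsupp.ext_iff]
      rw [faceExponents, Set.mem_ofPred_eq, hm]
      split_ifs with hj
      · subst hj
        exact ⟨fun h => h.1, fun h => ⟨h, by rw [h, map_zero]⟩⟩
      · simp only [Set.mem_empty_iff_false, iff_false, not_and]
        rintro rfl h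
        exact hj (by rw [← h, map_zero])
    rw [this]
    split_ifs <;> simp
  | insert s I hs ih =>
    rw [Finset.prod_insert hs, ← mul_assoc, ← ih]
    congr 1
    ext j
    rw [oneSubT, mul_sub, mul_one, HahnSeries.coeff_sub, HahnSeries.coeff_mul_single,
      HahnSeries.coeff_ofSuppBddBelow, HahnSeries.coeff_ofSuppBddBelow,
      ncard_faceExponents_insert hd hs]
    push_cast
    ring

theorem finrank_quotGrading_faceIdeal_eq_coeff (hd : ∀ i, 1 ≤ d i) (I : Finset (Fin n)) (j : ℤ) :
    (Module.finrank F (quotGrading (weightedHomogeneousSubmodule F fun i => (d i : ℤ))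
      (faceIdeal F I) j) : ℤ) = (Ring.inverse (∏ i ∈ I, oneSubT (d i))).coeff j := by
  rw [finrank_quotGrading_faceIdeal hd, ← ofSuppBddBelow_ncard_faceExponents hd,
    HahnSeries.coeff_ofSuppBddBelow]

end Face

section Pi

variable {F : Type u} [Field F] {n : ℕ} {d : Fin n → ℕ} {ι : Type} [Fintype ι]
  {C : ι → Type v} [∀ p, AddCommGroup (C p)] [∀ p, Module F (C p)]
  [∀ p, Module (MvPolynomial (Fin n) F) (C p)]
  {𝓒 : ∀ p, ℤ → Submodule F (C p)}

/-- The grading of `⨁_p C_p(-a_p)`. -/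
def piGrading (a : ι → ℤ) (𝓒 : ∀ p, ℤ → Submodule F (C p)) (j : ℤ) : Submodule F (∀ p, C p) :=
  Submodule.pi Set.univ fun p => 𝓒 p (j - a p)

omit [Fintype ι] in
theorem mem_piGrading {a : ι → ℤ} {j : ℤ} {x : ∀ p, C p} :
    x ∈ piGrading a 𝓒 j ↔ ∀ p, x p ∈ 𝓒 p (j - a p) := by
  simp [piGrading, Submodule.mem_pi]

theorem IsGradedModule.pi (h : ∀ p, IsGradedModule d (𝓒 p)) (a : ι → ℤ) :
    IsGradedModule d (piGrading a 𝓒) where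
  isInternal := by
    classical
    refine isInternal_of_components
      (fun j => LinearMap.pi fun p => homogComponent (h p).isInternal (j - a p) ∘ₗ LinearMap.proj p)
      ?_ ?_ ?_ ?_
    · intro j x hx
      exact funext fun p => homogComponent_self (h p).isInternal (mem_piGrading.mp hx p)
    · intro i j hij x hx
      refine funext fun p => ?_
      refine (homogComponent_of_mem (h p).isInternal _ (mem_piGrading.mp hx p)).trans (if_neg ?_)
      omega
    · intro j x
      exact mem_piGrading.mpr fun p => homogComponent_mem (h p).isInternal _ _
    · intro x
      choose s hs using fun p => exists_sum_homogComponent (h p).isInternal (x p)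
      refine ⟨Finset.univ.biUnion fun p => (s p).image (· + a p), funext fun p => ?_⟩
      rw [Finset.sum_apply]
      simp only [LinearMap.pi_apply, LinearMap.comp_apply, LinearMap.proj_apply]
      have hsub : (s p).image (· + a p) ⊆ Finset.univ.biUnion fun p => (s p).image (· + a p) :=
        Finset.subset_biUnion_of_mem (fun p => (s p).image (· + a p)) (Finset.mem_univ p)
      rw [← Finset.sum_subset hsub, Finset.sum_image fun _ _ _ _ h => add_right_cancel h]
      · simpa using hs p
      · intro j _ hj
        rw [← hs p, map_sum]
        refine Finset.sum_eq_zero fun i hi => ?_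
        rw [homogComponent_of_mem (h p).isInternal _ (homogComponent_mem (h p).isInternal i _),
          if_neg]
        rintro rfl
        exact hj (Finset.mem_image.mpr ⟨_, hi, by ring⟩)
  gradedSMul := ⟨by
    intro i j r x hr hx
    rw [mem_piGrading] at hx ⊢
    intro p
    have := (h p).gradedSMul.smul_mem hr (hx p)
    rwa [vadd_eq_add, ← add_sub_assoc] at this⟩

theorem IsFGGradedModule.pi (h : ∀ p, IsFGGradedModule d (𝓒 p)) (a : ι → ℤ) :
    IsFGGradedModule d (piGrading a 𝓒) :=
  { IsGradedModule.pi (fun p => (h p).toIsGradedModule) a with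
    finite := by
      have := fun p => (h p).finite
      infer_instance }

theorem finrank_piGrading [∀ p, IsScalarTower F (MvPolynomial (Fin n) F) (C p)]
    (hd : ∀ i, 1 ≤ d i) (h : ∀ p, IsFGGradedModule d (𝓒 p)) (a : ι → ℤ) (j : ℤ) :
    Module.finrank F (piGrading a 𝓒 j) = ∑ p, Module.finrank F (𝓒 p (j - a p)) := by
  have := fun p => (h p).finiteDimensional hd (j - a p)
  rw [← Module.finrank_pi_fintype]
  exact LinearEquiv.finrank_eq
    { toFun := fun x p => ⟨x.1 p, mem_piGrading.mp x.2 p⟩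
      invFun := fun x => ⟨fun p => x p, mem_piGrading.mpr fun p => (x p).2⟩
      map_add' := fun _ _ => rfl
      map_smul' := fun _ _ => rfl
      left_inv := fun _ => rfl
      right_inv := fun _ => rfl }

end Pi

/-! ### Modules with prescribed decomposition -/

section Regular

variable {F : Type u} [Field F] {n : ℕ} {d : Fin n → ℕ}

theorem faceMap_sum_X_pow (e : Fin n → ℕ) (he : ∀ i, e i ≠ 0) (I : Finset (Fin n)) :
    faceMap F I (∑ i, X i ^ e i) = ∑ i ∈ I, X i ^ e i := by
  classical
  have h : ∀ i, faceMap F I (X i ^ e i) = if i ∈ I then X i ^ e i else 0 := by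
    intro i
    by_cases hi : i ∈ I <;> simp [faceMap, hi, he i]
  rw [map_sum, Finset.sum_congr rfl fun i _ => h i, Finset.sum_ite_mem, Finset.univ_inter]

theorem irreducible_sum_X {I : Finset (Fin n)} (hI : I.Nonempty) :
    Irreducible (∑ i ∈ I, X i : MvPolynomial (Fin n) F) := by
  classical
  let c : Fin n →₀ F := Finsupp.equivFunOnFinite.symm fun i => if i ∈ I then 1 else 0
  have hc : ∀ i, c i = if i ∈ I then 1 else 0 := fun i => rfl
  have hsum : (∑ i ∈ I, X i : MvPolynomial (Fin n) F) = sumSMulX c := by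
    rw [sumSMulX, Finsupp.linearCombination_apply, Finsupp.sum_fintype _ _ (by simp)]
    simp [hc]
  rw [hsum]
  obtain ⟨i, hi⟩ := hI
  refine irreducible_sumSMulX c ⟨i, by simp [hc, hi]⟩ fun r hr => ?_
  have := hr i
  rw [hc, if_pos hi] at this
  exact isUnit_of_dvd_one this

/-- The point `X_a = t`, `X_b = -t`, at which `∑ X_i` vanishes, shows that `∑ X_i` does not divide
`∑ X_i^{i + 1}`. -/
theorem not_sum_X_dvd {I : Finset (Fin n)} (hI : 1 < I.card) :
    ¬ (∑ i ∈ I, X i : MvPolynomial (Fin n) F) ∣ ∑ i ∈ I, X i ^ (i.val + 1) := by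
  obtain ⟨a, ha, b, hb, hab⟩ := Finset.one_lt_card.mp hI
  rintro ⟨q, hq⟩
  let ψ : MvPolynomial (Fin n) F →ₐ[F] Polynomial F :=
    aeval fun i => if i = a then Polynomial.X else if i = b then -Polynomial.X else 0
  have hψ : ∀ i, ψ (X i) = if i = a then Polynomial.X else if i = b then -Polynomial.X else 0 :=
    fun i => aeval_X _ i
  have h := congrArg ψ hq
  rw [map_mul, map_sum, map_sum,
    Finset.sum_eq_add_of_mem a b ha hb hab fun c _ hc => by simp [hψ, hc.1, hc.2],
    Finset.sum_eq_add_of_mem a b ha hb hab fun c _ hc => by simp [hψ, hc.1, hc.2]] at h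
  simp only [map_pow, hψ, if_true, if_neg hab.symm, add_neg_cancel, zero_mul] at h
  have h' := congrArg (fun p => Polynomial.coeff p (a.val + 1)) h
  rw [neg_pow] at h'
  rcases neg_one_pow_eq_or (Polynomial F) (b.val + 1) with hs | hs <;>
    simp [hs, Polynomial.coeff_X_pow, Fin.val_ne_of_ne hab] at h'

variable {ι : Type} {I : ι → Finset (Fin n)}

theorem isSMulRegular_sum_X (hI : ∀ p, (I p).Nonempty) :
    IsSMulRegular (∀ p, MvPolynomial (Fin n) F ⧸ faceIdeal F (I p))
      (∑ i, X i : MvPolynomial (Fin n) F) := by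
  refine IsSMulRegular.pi fun p => ?_
  rw [isSMulRegular_quotient_iff_mem_of_smul_mem]
  intro x hx
  rw [mem_faceIdeal, smul_eq_mul, map_mul] at hx
  have h := faceMap_sum_X_pow (F := F) (fun _ => 1) (fun _ => one_ne_zero) (I p)
  simp only [pow_one] at h
  rw [h] at hx
  exact (mul_eq_zero.mp hx).resolve_left (irreducible_sum_X (hI p)).ne_zero

/-- The second step of the regular sequence: modulo the variables outside `I p`, the irreducible
element `∑ X_i` divides a multiple of `∑ X_i^{i + 1}` only if it divides the cofactor. -/
theorem isSMulRegular_sum_X_pow (hI : ∀ p, 1 < (I p).card) :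
    IsSMulRegular (QuotSMulTop (∑ i, X i : MvPolynomial (Fin n) F)
      (∀ p, MvPolynomial (Fin n) F ⧸ faceIdeal F (I p)))
      (∑ i : Fin n, X i ^ (i.val + 1) : MvPolynomial (Fin n) F) := by
  refine (isSMulRegular_quotient_iff_mem_of_smul_mem _ _).mpr ?_
  rintro x ⟨y, -, hy⟩
  have key : ∀ p, ∃ z : MvPolynomial (Fin n) F ⧸ faceIdeal F (I p),
      (∑ i, X i : MvPolynomial (Fin n) F) • z = x p := by
    intro p
    have hyp : (∑ i, X i : MvPolynomial (Fin n) F) • y p =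
      (∑ i : Fin n, X i ^ (i.val + 1) : MvPolynomial (Fin n) F) • x p := congrFun hy p
    obtain ⟨a, ha⟩ := Submodule.Quotient.mk_surjective _ (x p)
    obtain ⟨b, hb⟩ := Submodule.Quotient.mk_surjective _ (y p)
    rw [← ha, ← hb, ← Submodule.Quotient.mk_smul, ← Submodule.Quotient.mk_smul,
      Submodule.Quotient.eq, mem_faceIdeal, smul_eq_mul, smul_eq_mul, map_sub, map_mul, map_mul,
      sub_eq_zero, faceMap_sum_X_pow (F := F) (fun i => i.val + 1) (fun _ => by simp) (I p)] at hyp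
    have h := faceMap_sum_X_pow (F := F) (fun _ => 1) (fun _ => one_ne_zero) (I p)
    simp only [pow_one] at h
    rw [h] at hyp
    have hprime := (irreducible_sum_X (F := F) (I := I p)
      (Finset.card_pos.mp (by have := hI p; omega))).prime
    obtain ⟨c, hc⟩ := (hprime.dvd_or_dvd (Dvd.intro _ hyp)).resolve_left (not_sum_X_dvd (hI p))
    refine ⟨Submodule.Quotient.mk c, ?_⟩
    rw [← ha, ← Submodule.Quotient.mk_smul, Submodule.Quotient.eq, mem_faceIdeal, smul_eq_mul,
      map_sub, map_mul, h, sub_eq_zero, ← faceMap_faceMap _ a, hc, map_mul, ← h, faceMap_faceMap]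
  choose z hz using key
  exact ⟨z, trivial, funext hz⟩

theorem exists_isWeaklyRegular_pi {r : ℕ} (hr : r ≤ 2) (hI : ∀ p, r ≤ (I p).card) :
    ∃ rs : List (MvPolynomial (Fin n) F), rs.length = r ∧ (∀ f ∈ rs, f ∈ maxIdeal F n) ∧
      IsWeaklyRegular (∀ p, MvPolynomial (Fin n) F ⧸ faceIdeal F (I p)) rs := by
  have hX : ∀ i, (X i : MvPolynomial (Fin n) F) ∈ maxIdeal F n :=
    fun i => Ideal.subset_span ⟨i, rfl⟩
  have h1 : (∑ i, X i : MvPolynomial (Fin n) F) ∈ maxIdeal F n :=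
    Ideal.sum_mem _ fun i _ => hX i
  have h2 : (∑ i : Fin n, X i ^ (i.val + 1) : MvPolynomial (Fin n) F) ∈ maxIdeal F n :=
    Ideal.sum_mem _ fun i _ => Ideal.pow_mem_of_mem _ (hX i) _ i.val.succ_pos
  interval_cases r
  · exact ⟨[], rfl, by simp, IsWeaklyRegular.nil _ _⟩
  · refine ⟨[∑ i, X i], rfl, by simpa using h1, ?_⟩
    rw [isWeaklyRegular_singleton_iff]
    exact isSMulRegular_sum_X fun p => Finset.card_pos.mp (hI p)
  · refine ⟨[∑ i, X i, ∑ i : Fin n, X i ^ (i.val + 1)], rfl, by simpa using ⟨h1, h2⟩, ?_⟩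
    rw [isWeaklyRegular_cons_iff, isWeaklyRegular_singleton_iff]
    exact ⟨isSMulRegular_sum_X fun p => Finset.card_pos.mp (by have := hI p; omega),
      isSMulRegular_sum_X_pow hI⟩

end Regular

section Model

variable {F : Type u} [Field F] {n : ℕ} {d : Fin n → ℕ}

theorem IsFGGradedModule.length_le_depth {M : Type v} [AddCommGroup M] [Nontrivial M] [Module F M]
    [Module (MvPolynomial (Fin n) F) M] [IsScalarTower F (MvPolynomial (Fin n) F) M]
    {𝓜 : ℤ → Submodule F M} (hd : ∀ i, 1 ≤ d i) (h : IsFGGradedModule d 𝓜)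
    {rs : List (MvPolynomial (Fin n) F)} (hmem : ∀ f ∈ rs, f ∈ maxIdeal F n)
    (hreg : IsWeaklyRegular M rs) : (rs.length : ℕ∞) ≤ depth F n M := by
  have hregular : IsRegular M rs := by
    refine ⟨hreg, fun htop => (h.maxIdeal_smul_top_lt hd).ne (eq_top_iff.mpr
      (htop.le.trans (Submodule.smul_mono_left (Ideal.span_le.mpr hmem))))⟩
  exact le_iSup (fun rs : {rs : List (MvPolynomial (Fin n) F) //
    (∀ r ∈ rs, r ∈ maxIdeal F n) ∧ IsRegular M rs} => (rs.1.length : ℕ∞)) ⟨rs, hmem, hregular⟩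

/-- A decomposition of a nonzero Hilbert series with all denominators involving at least `r ≤ 2`
variables is realized by a direct sum of shifted copies of the modules `F[X_i : i ∈ I]`, on which
there is a regular sequence of length `r`. -/
theorem IsDecomposition.exists_module (hd : ∀ i, 1 ≤ d i) {H : LaurentSeries ℤ} (hH : H ≠ 0)
    {Q : Finset (Fin n) → LaurentPolynomial ℤ} (hQ : IsDecomposition d H Q) {r : ℕ} (hr : r ≤ 2)
    (hQr : ∀ I : Finset (Fin n), I.card < r → Q I = 0) :
    ∃ (N : Type u) (_ : AddCommGroup N) (_ : Module F N)
      (_ : Module (MvPolynomial (Fin n) F) N) (_ : IsScalarTower F (MvPolynomial (Fin n) F) N)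
      (𝓝 : ℤ → Submodule F N) (h : IsFGGradedModule d 𝓝),
      hilbertSeries h = H ∧ (r : ℕ∞) ≤ depth F n N := by
  classical
  let ι : Type := Σ I : Finset (Fin n), Σ k : (Q I).coeff.support, Fin ((Q I).coeff k).toNat
  have h : ∀ p : ι, IsFGGradedModule d (quotGrading
      (weightedHomogeneousSubmodule F fun i => (d i : ℤ)) (faceIdeal F p.1)) := fun p =>
    isFGGradedModule_mvPolynomial.quotient (isHomogeneousSubmodule_faceIdeal p.1)
  have hN := IsFGGradedModule.pi h fun p => (p.2.1 : ℤ)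
  have hHN : hilbertSeries hN = H := by
    rw [hQ.2]
    ext j
    rw [coeff_hilbertSeries, finrank_piGrading hd h]
    push_cast
    simp_rw [finrank_quotGrading_faceIdeal_eq_coeff hd]
    rw [Fintype.sum_sigma, HahnSeries.coeff_sum]
    refine Finset.sum_congr rfl fun I _ => ?_
    rw [Fintype.sum_sigma, laurentPolynomialToSeries, Finsupp.sum, Finset.sum_mul,
      HahnSeries.coeff_sum, ← Finset.sum_coe_sort (Q I).coeff.support]
    refine Finset.sum_congr rfl fun k _ => ?_
    dsimp only
    rw [mul_comm, HahnSeries.coeff_mul_single, Finset.sum_const, Finset.card_univ, Fintype.card_fin,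
      nsmul_eq_mul, mul_comm, Int.toNat_of_nonneg (hQ.1 I k)]
  have hnt : Nontrivial (∀ p : ι, MvPolynomial (Fin n) F ⧸ faceIdeal F p.1) := by
    by_contra hcon
    rw [not_nontrivial_iff_subsingleton] at hcon
    apply hH
    rw [← hHN]
    ext j
    rw [coeff_hilbertSeries, Module.finrank_zero_of_subsingleton]
    rfl
  have hI : ∀ p : ι, r ≤ p.1.card := by
    intro p
    by_contra hlt
    have hk := Finsupp.mem_support_iff.mp p.2.1.2
    exact hk (by simp [hQr p.1 (by omega)])
  obtain ⟨rs, hlen, hmem, hreg⟩ := exists_isWeaklyRegular_pi (F := F) hr hI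
  refine ⟨_, _, _, _, inferInstance, _, hN, hHN, ?_⟩
  rw [← hlen]
  exact hN.length_le_depth hd hmem hreg

end Model

/-! ### The two invariants -/

section Invariants

variable {F : Type u} [Field F] {n : ℕ} {d : Fin n → ℕ}
  {M : Type v} [AddCommGroup M] [Module F M] [Module (MvPolynomial (Fin n) F) M]

omit [Module F M] in
theorem exists_isRegular_of_le_depth [Nontrivial M] {k : ℕ} (hk : (k : ℕ∞) ≤ depth F n M) :
    ∃ rs : List (MvPolynomial (Fin n) F), k ≤ rs.length ∧ (∀ r ∈ rs, r ∈ maxIdeal F n) ∧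
      IsRegular M rs := by
  by_contra! hcon
  have hpos : k ≠ 0 := by
    rintro rfl
    exact hcon [] (Nat.zero_le _) (by simp) (IsRegular.nil _ _)
  have hle : depth F n M ≤ (k - 1 : ℕ) := by
    refine iSup_le fun rs => ?_
    have : ¬ k ≤ rs.1.length := fun h => hcon _ h rs.2.1 rs.2.2
    exact_mod_cast (by omega : rs.1.length ≤ k - 1)
  have : k ≤ k - 1 := by exact_mod_cast hk.trans hle
  omega

omit [Module F M] in
theorem socle_eq_zero_of_one_le_depth [Nontrivial M] (h : 1 ≤ depth F n M) (x : M)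
    (hx : ∀ i, (X i : MvPolynomial (Fin n) F) • x = 0) : x = 0 := by
  obtain ⟨rs, hlen, hmem, hreg⟩ := exists_isRegular_of_le_depth (k := 1) (by simpa using h)
  match rs with
  | [] => simp at hlen
  | f :: rs =>
    have hle : maxIdeal F n ≤
        LinearMap.ker (LinearMap.toSpanSingleton (MvPolynomial (Fin n) F) M x) := by
      rw [maxIdeal, Ideal.span_le]
      rintro _ ⟨i, rfl⟩
      exact hx i
    have hf : f • x = 0 := hle (hmem f List.mem_cons_self)
    exact ((isRegular_cons_iff _ _ _).mp hreg).1 (hf.trans (smul_zero f).symm)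

variable [IsScalarTower F (MvPolynomial (Fin n) F) M] {𝓜 : ℤ → Submodule F M}

theorem IsFGGradedModule.hilbertSeries_ne_zero [Nontrivial M] (hd : ∀ i, 1 ≤ d i)
    (h : IsFGGradedModule d 𝓜) : hilbertSeries h ≠ 0 := by
  intro h0
  obtain ⟨j, hj⟩ := h.exists_component_ne_bot
  have := h.finiteDimensional hd j
  have hc := congrArg (fun H => HahnSeries.coeff H j) h0
  simp only [coeff_hilbertSeries, HahnSeries.coeff_zero, Nat.cast_eq_zero] at hc
  exact hj (Submodule.finrank_eq_zero.mp hc)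

omit [IsScalarTower F (MvPolynomial (Fin n) F) M] in
theorem nontrivial_of_hilbertSeries_ne_zero (h : IsFGGradedModule d 𝓜)
    (hH : hilbertSeries h ≠ 0) : Nontrivial M := by
  by_contra hcon
  rw [not_nontrivial_iff_subsingleton] at hcon
  apply hH
  ext j
  rw [coeff_hilbertSeries, Module.finrank_zero_of_subsingleton]
  rfl

theorem IsFGGradedModule.exists_depth_eq (hd : ∀ i, 1 ≤ d i) (h : IsFGGradedModule d 𝓜) :
    ∃ r : ℕ, depth F n M = r := by
  obtain ⟨r, hr⟩ := ENat.ne_top_iff_exists.mp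
    (ne_top_of_le_ne_top (ENat.natCast_ne_top n) (h.depth_le hd))
  exact ⟨r, hr.symm⟩

theorem IsFGGradedModule.comap_equiv (h : IsFGGradedModule d 𝓜) {N : Type*} [AddCommGroup N]
    [Module F N] [Module (MvPolynomial (Fin n) F) N] [IsScalarTower F (MvPolynomial (Fin n) F) N]
    (e : N ≃ₗ[MvPolynomial (Fin n) F] M) :
    IsFGGradedModule d fun j => (𝓜 j).comap (e.restrictScalars F).toLinearMap where
  isInternal := by
    refine isInternal_of_components (fun j => (e.restrictScalars F).symm.toLinearMap ∘ₗ
      homogComponent h.isInternal j ∘ₗ (e.restrictScalars F).toLinearMap) ?_ ?_ ?_ ?_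
    · intro j x hx
      apply e.injective
      exact (e.apply_symm_apply _).trans (homogComponent_self h.isInternal hx)
    · intro i j hij x hx
      apply e.injective
      exact (e.apply_symm_apply _).trans
        (((homogComponent_of_mem h.isInternal j hx).trans (if_neg hij)).trans (map_zero e).symm)
    · intro j x
      have := homogComponent_mem h.isInternal j (e x)
      rwa [← e.apply_symm_apply (homogComponent h.isInternal j (e x))] at this
    · intro x
      obtain ⟨s, hs⟩ := exists_sum_homogComponent h.isInternal (e x)
      refine ⟨s, e.injective ?_⟩
      rw [map_sum]
      exact (Finset.sum_congr rfl fun j _ => e.apply_symm_apply _).trans hs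
  gradedSMul := ⟨by
    intro i j r x hr hx
    have := h.gradedSMul.smul_mem hr hx
    rw [Submodule.mem_comap]
    change e (r • x) ∈ _
    rw [map_smul]
    exact this⟩
  finite := by
    have := h.finite
    exact Module.Finite.equiv e.symm

/-- The Hilbert series of a finitely generated graded module is that of a module in the universe
of `F`. -/
theorem nonempty_hilbertDepthSet (hd : ∀ i, 1 ≤ d i) (h : IsFGGradedModule d 𝓜) :
    (hilbertDepthSet F d (hilbertSeries h)).Nonempty := by
  have := h.finite
  obtain ⟨k, f, hf⟩ := Module.Finite.exists_fin' (MvPolynomial (Fin n) F) M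
  have : Small.{u} M := small_of_surjective hf
  have hsmul : ∀ (p : MvPolynomial (Fin n) F) (x : Shrink.{u} M),
      Shrink.linearEquiv F M (p • x) = p • Shrink.linearEquiv F M x :=
    fun p x => map_smul (Shrink.linearEquiv (MvPolynomial (Fin n) F) M) p x
  have htower : IsScalarTower F (MvPolynomial (Fin n) F) (Shrink.{u} M) := ⟨fun a p x => by
    apply (Shrink.linearEquiv F M).injective
    rw [LinearEquiv.map_smul, hsmul, hsmul, smul_assoc]⟩
  let e : Shrink.{u} M ≃ₗ[MvPolynomial (Fin n) F] M := Shrink.linearEquiv _ M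
  have hgr := h.comap_equiv e
  obtain ⟨r, hr⟩ := hgr.exists_depth_eq hd
  refine ⟨r, _, _, _, _, htower, _, hgr, ?_, hr⟩
  ext j
  rw [coeff_hilbertSeries, coeff_hilbertSeries,
    ← ((e.restrictScalars F).finrank_map_eq ((𝓜 j).comap (e.restrictScalars F).toLinearMap)),
    Submodule.map_comap_eq_of_surjective (e.restrictScalars F).surjective]

theorem le_of_mem_hilbertDepthSet (hd : ∀ i, 1 ≤ d i) {H : LaurentSeries ℤ} {r : ℕ}
    (hr : r ∈ hilbertDepthSet F d H) : r ≤ n := by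
  obtain ⟨N, _, _, _, _, 𝓝, h, -, hdep⟩ := hr
  have := h.depth_le hd
  rw [hdep] at this
  exact_mod_cast this

theorem le_of_mem_nuSet {H : LaurentSeries ℤ} (hH : H ≠ 0) {r : ℕ} (hr : r ∈ nuSet d H) :
    r ≤ n := by
  obtain ⟨Q, hQ, hQr⟩ := hr
  by_contra hlt
  apply hH
  rw [hQ.2]
  refine Finset.sum_eq_zero fun I _ => ?_
  have := I.card_le_univ
  rw [Fintype.card_fin] at this
  rw [hQr I (by omega), laurentPolynomialToSeries_zero, zero_mul]

theorem one_mem_nuSet (hd : ∀ i, 1 ≤ d i) {H : LaurentSeries ℤ} (hH : H ≠ 0)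
    (h : 1 ∈ hilbertDepthSet F d H) : 1 ∈ nuSet d H := by
  obtain ⟨N, _, _, _, _, 𝓝, h, rfl, hdep⟩ := h
  have := nontrivial_of_hilbertSeries_ne_zero h hH
  obtain ⟨Q, hQ, hQ0⟩ := h.exists_isDecomposition hd
  refine ⟨Q, hQ, fun I hI => ?_⟩
  rw [Nat.lt_one_iff, Finset.card_eq_zero] at hI
  rw [hI]
  exact hQ0 (socle_eq_zero_of_one_le_depth (by simp [hdep]))

theorem numVars_mem_nuSet (hd : ∀ i, 1 ≤ d i) {H : LaurentSeries ℤ} (hH : H ≠ 0)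
    (h : n ∈ hilbertDepthSet F d H) : n ∈ nuSet d H := by
  obtain ⟨N, _, _, _, _, 𝓝, h, rfl, hdep⟩ := h
  have := nontrivial_of_hilbertSeries_ne_zero h hH
  obtain ⟨rs, hlen, hmem, hreg⟩ := exists_isRegular_of_le_depth hdep.ge
  obtain ⟨q, hq, hqs⟩ := exists_hilbertSeries_mul_prod_eq hd Finset.univ N 𝓝 h (by simp)
    ⟨rs, by simpa using (h.length_le hd hmem hreg).antisymm hlen, hmem, hreg⟩
  refine ⟨fun I => if I = Finset.univ then q else 0, ⟨fun I k => ?_, ?_⟩, fun I hI => if_neg ?_⟩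
  · dsimp only
    split_ifs
    · exact hq k
    · simp
  · rw [Finset.sum_eq_single Finset.univ]
    · dsimp only
      rw [if_pos rfl, ← hqs, mul_assoc, Ring.mul_inverse_cancel _ (isUnit_prod_oneSubT hd _),
        mul_one]
    · intro I _ hI
      dsimp only
      rw [if_neg hI, laurentPolynomialToSeries_zero, zero_mul]
    · simp
  · rintro rfl
    simp at hI

theorem nu_le_Hdep (hd : ∀ i, 1 ≤ d i) {H : LaurentSeries ℤ} (hH : H ≠ 0)
    (hmax : IsGreatest (hilbertDepthSet F d H) (Hdep F d H)) (hnu : nu d H ∈ nuSet d H)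
    (h1 : Hdep F d H ≤ 1) : nu d H ≤ Hdep F d H := by
  by_contra! hlt
  obtain ⟨Q, hQ, hQr⟩ := hnu
  obtain ⟨N, _, _, _, _, 𝓝, h, hHN, hdep⟩ := hQ.exists_module (F := F) hd hH
    (r := Hdep F d H + 1) (by omega) fun I hI => hQr I (by omega)
  obtain ⟨r, hr⟩ := h.exists_depth_eq hd
  have := hmax.2 ⟨N, _, _, _, inferInstance, 𝓝, h, hHN, hr⟩
  rw [hr] at hdep
  have : Hdep F d H + 1 ≤ r := by exact_mod_cast hdep
  omega

end Invariants

end HilbertDepth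

/-- The first two conjuncts say that the maxima defining `Hdep M` and `ν M` exist. -/
theorem corollary2p5 {F : Type u} [Field F] {n : ℕ} (d : Fin n → ℕ) (hd : ∀ i, 1 ≤ d i)
    {M : Type v} [AddCommGroup M] [Nontrivial M] [Module F M] [Module (MvPolynomial (Fin n) F) M]
    [IsScalarTower F (MvPolynomial (Fin n) F) M]
    (𝓜 : ℤ → Submodule F M) (hM : HilbertDepth.IsFGGradedModule d 𝓜) :
    IsGreatest (HilbertDepth.hilbertDepthSet F d (HilbertDepth.hilbertSeries hM))
      (HilbertDepth.Hdep F d (HilbertDepth.hilbertSeries hM)) ∧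
    IsGreatest (HilbertDepth.nuSet d (HilbertDepth.hilbertSeries hM))
      (HilbertDepth.nu d (HilbertDepth.hilbertSeries hM)) ∧
    (HilbertDepth.Hdep F d (HilbertDepth.hilbertSeries hM) ≤ 1 ∨
        HilbertDepth.Hdep F d (HilbertDepth.hilbertSeries hM) = n →
      HilbertDepth.nu d (HilbertDepth.hilbertSeries hM) =
        HilbertDepth.Hdep F d (HilbertDepth.hilbertSeries hM)) := by
  have hH := hM.hilbertSeries_ne_zero hd
  have hbdd : BddAbove (HilbertDepth.hilbertDepthSet F d (HilbertDepth.hilbertSeries hM)) :=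
    ⟨n, fun r hr => HilbertDepth.le_of_mem_hilbertDepthSet hd hr⟩
  have hbdd' : BddAbove (HilbertDepth.nuSet d (HilbertDepth.hilbertSeries hM)) :=
    ⟨n, fun r hr => HilbertDepth.le_of_mem_nuSet hH hr⟩
  have hdep : IsGreatest (HilbertDepth.hilbertDepthSet F d (HilbertDepth.hilbertSeries hM))
      (HilbertDepth.Hdep F d (HilbertDepth.hilbertSeries hM)) :=
    ⟨Nat.sSup_mem (HilbertDepth.nonempty_hilbertDepthSet hd hM) hbdd, fun r hr => le_csSup hbdd hr⟩
  have hnu : IsGreatest (HilbertDepth.nuSet d (HilbertDepth.hilbertSeries hM))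
      (HilbertDepth.nu d (HilbertDepth.hilbertSeries hM)) := by
    obtain ⟨Q, hQ, -⟩ := hM.exists_isDecomposition hd
    exact ⟨Nat.sSup_mem ⟨0, Q, hQ, by simp⟩ hbdd', fun r hr => le_csSup hbdd' hr⟩
  refine ⟨hdep, hnu, ?_⟩
  rintro (h1 | hn)
  · refine (HilbertDepth.nu_le_Hdep hd hH hdep hnu.1 h1).antisymm ?_
    rcases Nat.le_one_iff_eq_zero_or_eq_one.mp h1 with h0 | h1
    · rw [h0]
      exact Nat.zero_le _
    · rw [h1]
      exact hnu.2 (HilbertDepth.one_mem_nuSet hd hH (h1 ▸ hdep.1))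
  · rw [hn]
    exact (HilbertDepth.le_of_mem_nuSet hH hnu.1).antisymm
      (hnu.2 (HilbertDepth.numVars_mem_nuSet (F := F) hd hH
        (Set.mem_of_eq_of_mem hn.symm hdep.1)))
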